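/- A fractional dilate is a finitely supported function $\gamma:\mathbb{Z}\to[0,\infty)$; its size is $\|\gamma\|=\inf_{0<p<1}\sum_{n\in\mathbb{Z}}\gamma(n)^p$, and it is called spartan if $\sum_{n:\gamma(n)\neq 0}\gamma(n)\log\gamma(n)<0$. A fractional set is a fractional dilate all of whose values are at most $1$. For fractional sets $\alpha,\beta$ and an integer $k$, $\alpha+k\cdot\beta$ is the fractional dilate $(\alpha+k\cdot\beta)(n)=\sum_{i+kj=n}\alpha(i)\beta(j)$. A random set $S\subseteq\mathbb{Z}^n$ is drawn from $\alpha^n$ if the events $x\in S$ $(x\in\mathbb{Z}^n)$ are independent and $\Pr(x\in S)=\alpha(x_1)\cdots\alpha(x_n)$ for every $x$. For $A,B\subseteq\mathbb{Z}^n$ write $A+k\cdot B=\{a+kb: a\in A, b\in B\}$. **Theorem.** Let $\alpha$ and $\beta$ be fractional sets, let $k$ be a non-zero integer, and for each $n$ let $S_n,T_n\subseteq\mathbb{Z}^n$ be independent random sets drawn from $\alpha^n$ and $\beta^n$ respectively. Then $$\lim_{n\to\infty}\bigl(\mathbb{E}|S_n+k\cdot T_n|\bigr)^{1/n}=\|\alpha+k\cdot\beta\|,$$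 $$\lim_{n\to\infty}\bigl(\mathbb{E}|S_n+k\cdot S_n|\bigr)^{1/n}=\begin{cases}\|\alpha+k\cdot\alpha\| & \text{if }\|\alpha\|\ge 1,\\ \|\alpha\| & \text{otherwise.}\end{cases}$$ Furthermore, if $\alpha+k\cdot\beta$ is spartan, then $$\mathbb{E}\bigl(|S_n||T_n|-|S_n+k\cdot T_n|\bigr)=o\bigl(\|\alpha+k\cdot\beta\|^n\bigr).$$ Similarly, if $\alpha+k\cdot\alpha$ is spartan, and if moreover $\|\alpha\|>1$ in case $k=1$ or $k=-1$, then $$\mathbb{E}\bigl(|S_n|^2-|S_n+k\cdot S_n|\bigr)=o\bigl(\|\alpha+k\cdot\alpha\|^n\bigr)\quad\text{if }k\neq 1,$$ $$\mathbb{E}\Bigl(\tfrac12|S_n|^2-|S_n+k\cdot S_n|\Bigr)=o\bigl(\|\alpha+k\cdot\alpha\|^n\bigr)\quad\text{if }k=1.$$ -/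

import Mathlib

open MeasureTheory ProbabilityTheory Filter Topology Asymptotics
open scoped NNReal ENNReal

noncomputable section

/-- A fractional dilate: a finitely supported map from the integers to the non-negative reals. -/
abbrev FractionalDilate : Type := ℤ →₀ ℝ≥0

namespace FractionalDilate

/-- The size `‖γ‖ = inf_{0 < p < 1} ∑ₙ γ(n)^p`
(the terms outside the support vanish, since `0 ^ p = 0` for `p > 0`). -/
def size (γ : FractionalDilate) : ℝ :=
  ⨅ p : Set.Ioo (0 : ℝ) 1, ∑ n ∈ γ.support, (γ n : ℝ) ^ (p : ℝ)

/-- A fractional set is a fractional dilate with all values at most one. -/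
def IsFractionalSet (α : FractionalDilate) : Prop :=
  ∀ n : ℤ, α n ≤ 1

/-- The fractional dilate `α + k·β`, i.e. `(α + k·β)(n) = ∑_{i + k j = n} α(i) β(j)`. -/
def addDilate (α : FractionalDilate) (k : ℤ) (β : FractionalDilate) : FractionalDilate :=
  ∑ i ∈ α.support, ∑ j ∈ β.support, Finsupp.single (i + k * j) (α i * β j)

theorem addDilate_apply (α : FractionalDilate) (k : ℤ) (β : FractionalDilate) (n : ℤ) :
    addDilate α k β n =
      ∑ q ∈ (α.support ×ˢ β.support).filter (fun q => q.1 + k * q.2 = n), α q.1 * β q.2 := by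
  classical
  rw [Finset.sum_filter, Finset.sum_product]
  simp only [addDilate, Finsupp.finsetSum_apply, Finsupp.single_apply]

/-- `γ` is spartan if `∑_{n : γ(n) ≠ 0} γ(n) log γ(n) < 0`. -/
def IsSpartan (γ : FractionalDilate) : Prop :=
  ∑ n ∈ γ.support, (γ n : ℝ) * Real.log (γ n : ℝ) < 0

end FractionalDilate

/-- The random set `S ⊆ ℤⁿ` is drawn from `αⁿ`: every `x ∈ ℤⁿ` belongs to `S` with probability
`α(x₁) ⋯ α(xₙ)`, independently for different `x`. (Measurability of `S` means measurability of all
the events `x ∈ S`.) -/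
structure IsDrawnFrom {Ω : Type*} [MeasurableSpace Ω] {n : ℕ} (P : Measure Ω)
    (S : Ω → Set (Fin n → ℤ)) (α : FractionalDilate) : Prop where
  measurable : Measurable S
  indep : iIndepSet (fun x : Fin n → ℤ => {ω | x ∈ S ω}) P
  prob : ∀ x : Fin n → ℤ, P {ω | x ∈ S ω} = ∏ i, (α (x i) : ℝ≥0∞)

/-- The sumset `A + k·B = {a + k b : a ∈ A, b ∈ B}`. -/
def sumDilate {n : ℕ} (A : Set (Fin n → ℤ)) (k : ℤ) (B : Set (Fin n → ℤ)) :
    Set (Fin n → ℤ) :=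
  Set.image2 (fun a b => a + k • b) A B

end

/-! Write γ = α + k·β and γ(z) = ∏ γ(zᵢ). By linearity, E|S + k·T| is the sum over z of the
probability that some pair (x, y) with x + k y = z is drawn; the expected number of such pairs is
γ(z). A pair in this fibre is determined by either coordinate, so for independent S, T the hits in a
fibre are pairwise independent. The first and second moments then put the probability between min(1,
γ(z))/4 and min(1, γ(z)) (`min_one_div_four_le_measureReal_biUnion`).

It remains to see that ∑ min(1, γ(z)) grows like ‖γ‖ⁿ, a Cramér-type estimate. Let F(p) = ∑ γ(m)^p,
so ∑ γ(z)^p = F(p)ⁿ, and let p minimise F on [0, 1]. Above, min(1, t) ≤ t^p. Below, stationarity of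
p makes the tilted weights γ(z)^p concentrate where |log γ(z)| ≤ εn, up to exponentially smaller
tails; there min(1, t) and t^p agree up to a factor e^(εn). At an endpoint p = 0 or p = 1 only one
tail matters.

If γ is spartan, F'(1) < 0, so ‖γ‖ = F(1) and F(1 + δ) < F(1) for some δ in (0, 1). The loss at z
through repeated sums is at most min(γ(z), γ(z)²) ≤ γ(z)^(1+δ), and F(1 + δ)ⁿ = o(F(1)ⁿ).

For S + k·S two effects are new. Diagonal pairs (x, x) have probability α(x) instead of α(x)²; their
total is ‖α‖ⁿ, which is absorbed if ‖α‖ ≥ 1 and governs the growth if ‖α‖ < 1. Pairs (x, y), (y, y')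
in one fibre share a point. For k ≠ 1 the three points are distinct and such chains contribute an
n-th power of base less than F(1); for k = 1 the second pair is the reversal of the first, whence
the factor 1/2. -/

/-! ### Calculus: one-sided descent, n-th roots, truncation. -/

/-- A function with negative derivative takes smaller values arbitrarily close to the right. -/
theorem HasDerivAt.exists_add_lt {h : ℝ → ℝ} {d a η : ℝ} (hd : HasDerivAt h d a) (hneg : d < 0)
    (hη : 0 < η) : ∃ δ, 0 < δ ∧ δ < η ∧ h (a + δ) < h a := by
  have hs := hasDerivAt_iff_tendsto_slope.1 hd
  have h1 : ∀ᶠ x in 𝓝[≠] a, slope h a x < 0 := hs.eventually (gt_mem_nhds hneg)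
  have h2 : ∀ᶠ x in 𝓝[>] a, slope h a x < 0 :=
    h1.filter_mono (nhdsWithin_mono _ fun x hx => ne_of_gt hx)
  obtain ⟨x, hx, hxa, hxη⟩ := (h2.and (Ioo_mem_nhdsGT (show a < a + η by linarith))).exists
  refine ⟨x - a, by linarith, by linarith, ?_⟩
  rw [slope_def_field, div_neg_iff] at hx
  rw [add_sub_cancel]
  rcases hx with hx | hx <;> linarith

theorem HasDerivAt.exists_sub_lt {h : ℝ → ℝ} {d a η : ℝ} (hd : HasDerivAt h d a) (hpos : 0 < d)
    (hη : 0 < η) : ∃ δ, 0 < δ ∧ δ < η ∧ h (a - δ) < h a := by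
  have hd' : HasDerivAt (fun x => h (-x)) (-d) (-a) := by
    have := HasDerivAt.comp (-a) (h₂ := h) (h := fun x : ℝ => -x) (by simpa using hd)
      (hasDerivAt_neg (-a))
    simpa [Function.comp_def] using this
  obtain ⟨δ, h0, h1, h2⟩ := hd'.exists_add_lt (neg_lt_zero.2 hpos) hη
  refine ⟨δ, h0, h1, ?_⟩
  simpa [sub_eq_add_neg, add_comm] using h2

theorem tendsto_const_rpow_one_div {c : ℝ} (hc : 0 < c) :
    Tendsto (fun n : ℕ => c ^ (1 / (n : ℝ))) atTop (𝓝 1) := by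
  have h := (Real.continuous_const_rpow hc.ne').tendsto 0
  rw [Real.rpow_zero] at h
  exact h.comp tendsto_one_div_atTop_nhds_zero_nat

/-- The `n`-th root of a sequence that is `G ^ n` up to subexponential factors tends to `G`. -/
theorem tendsto_rpow_one_div_of_bounds {u : ℕ → ℝ} {G C : ℝ} (hG : 0 ≤ G) (hu : ∀ n, 0 ≤ u n)
    (hC : 0 < C) (hup : ∀ n, u n ≤ C * G ^ n)
    (hlow : ∀ ε : ℝ, 0 < ε → ∃ c : ℝ, 0 < c ∧ ∀ᶠ n in atTop, c * (Real.exp (-ε) * G) ^ n ≤ u n) :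
    Tendsto (fun n : ℕ => u n ^ (1 / (n : ℝ))) atTop (𝓝 G) := by
  have root : ∀ {c g : ℝ} {n : ℕ}, 0 ≤ c → 0 ≤ g → n ≠ 0 →
      (c * g ^ n) ^ (1 / (n : ℝ)) = c ^ (1 / (n : ℝ)) * g := by
    intro c g n hc hg hn
    rw [Real.mul_rpow hc (by positivity), one_div, Real.pow_rpow_inv_natCast hg hn]
  refine tendsto_order.2 ⟨fun a ha => ?_, fun a ha => ?_⟩
  · have hcont : Tendsto (fun ε : ℝ => Real.exp (-ε) * G) (𝓝[>] 0) (𝓝 G) := by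
      have : Continuous fun ε : ℝ => Real.exp (-ε) * G := by fun_prop
      simpa using (this.tendsto 0).mono_left nhdsWithin_le_nhds
    obtain ⟨ε, hεa, hε⟩ := ((hcont.eventually (lt_mem_nhds ha)).and self_mem_nhdsWithin).exists
    obtain ⟨c, hc, hcu⟩ := hlow ε hε
    have hlim : Tendsto (fun n : ℕ => c ^ (1 / (n : ℝ)) * (Real.exp (-ε) * G)) atTop
        (𝓝 (1 * (Real.exp (-ε) * G))) := (tendsto_const_rpow_one_div hc).mul_const _
    rw [one_mul] at hlim
    filter_upwards [hcu, hlim.eventually (lt_mem_nhds hεa), eventually_ne_atTop 0] with n h1 h2 h3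
    refine h2.trans_le ?_
    rw [← root hc.le (by positivity) h3]
    exact Real.rpow_le_rpow (by positivity) h1 (by positivity)
  · have hlim : Tendsto (fun n : ℕ => C ^ (1 / (n : ℝ)) * G) atTop (𝓝 (1 * G)) :=
      (tendsto_const_rpow_one_div hC).mul_const _
    rw [one_mul] at hlim
    filter_upwards [hlim.eventually (gt_mem_nhds ha), eventually_ne_atTop 0] with n h2 h3
    refine lt_of_le_of_lt ?_ h2
    rw [← root hC.le hG h3]
    exact Real.rpow_le_rpow (hu n) (hup n) (by positivity)

/-- The truncation `min 1 t` in terms of powers of `t` with exponents near `p`. -/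
theorem exp_neg_mul_rpow_le_min_one {t p s : ℝ} (ht : 0 < t) (hp0 : 0 ≤ p) (hp1 : p ≤ 1)
    (hs : 0 ≤ s) (hup : p = 0 ∨ t ≤ Real.exp s) (hlow : p = 1 ∨ Real.exp (-s) ≤ t) :
    Real.exp (-s) * t ^ p ≤ min 1 t := by
  obtain ⟨x, rfl⟩ : ∃ x, t = Real.exp x := ⟨Real.log t, (Real.exp_log ht).symm⟩
  rw [← Real.exp_mul, ← Real.exp_add]
  rw [Real.exp_le_exp] at hup hlow
  refine le_min (Real.exp_le_one_iff.2 ?_) (Real.exp_le_exp.2 ?_)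
  · rcases hup with rfl | hup
    · linarith
    · nlinarith
  · rcases hlow with rfl | hlow
    · linarith
    · nlinarith

/-! ### Power sums and large deviations of product weights. -/

namespace FractionalDilate

/-- The power sum `∑ γ(n) ^ p` over the support. -/
noncomputable def powSum (γ : FractionalDilate) (p : ℝ) : ℝ := ∑ n ∈ γ.support, (γ n : ℝ) ^ p

/-- The product `γ(z₁) ⋯ γ(zₙ)`. -/
noncomputable def weight (γ : FractionalDilate) {n : ℕ} (z : Fin n → ℤ) : ℝ := ∏ i, (γ (z i) : ℝ)

/-- The `n`-th power of the support. -/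
def box (γ : FractionalDilate) (n : ℕ) : Finset (Fin n → ℤ) :=
  Fintype.piFinset fun _ => γ.support

theorem coe_pos_of_mem {γ : FractionalDilate} {i : ℤ} (hi : i ∈ γ.support) : 0 < (γ i : ℝ) :=
  NNReal.coe_pos.2 (pos_iff_ne_zero.2 (Finsupp.mem_support_iff.1 hi))

theorem weight_nonneg (γ : FractionalDilate) {n : ℕ} (z : Fin n → ℤ) : 0 ≤ γ.weight z :=
  Finset.prod_nonneg fun _ _ => NNReal.coe_nonneg _

theorem weight_pos {γ : FractionalDilate} {n : ℕ} {z : Fin n → ℤ} (hz : z ∈ γ.box n) :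
    0 < γ.weight z :=
  Finset.prod_pos fun i _ => coe_pos_of_mem (Fintype.mem_piFinset.1 hz i)

theorem IsFractionalSet.coe_le_one {α : FractionalDilate} (hα : α.IsFractionalSet) (i : ℤ) :
    (α i : ℝ) ≤ 1 := NNReal.coe_le_one.2 (hα i)

theorem IsFractionalSet.weight_le_one {α : FractionalDilate} (hα : α.IsFractionalSet) {n : ℕ}
    (z : Fin n → ℤ) : α.weight z ≤ 1 :=
  Finset.prod_le_one (fun _ _ => NNReal.coe_nonneg _) fun _ _ => hα.coe_le_one _

theorem sum_weight_rpow (γ : FractionalDilate) (n : ℕ) (p : ℝ) :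
    ∑ z ∈ γ.box n, γ.weight z ^ p = γ.powSum p ^ n := by
  have h : γ.powSum p ^ n = ∏ _i : Fin n, ∑ j ∈ γ.support, (γ j : ℝ) ^ p := by
    simp [powSum]
  rw [h, Finset.prod_univ_sum]
  refine Finset.sum_congr rfl fun z _ => ?_
  exact (Real.finsetProd_rpow _ _ (fun _ _ => NNReal.coe_nonneg _) _).symm

theorem powSum_one (γ : FractionalDilate) : γ.powSum 1 = ∑ n ∈ γ.support, (γ n : ℝ) := by
  simp [powSum]

theorem sum_weight (γ : FractionalDilate) (n : ℕ) :
    ∑ z ∈ γ.box n, γ.weight z = γ.powSum 1 ^ n := by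
  simpa using γ.sum_weight_rpow n 1

theorem powSum_nonneg (γ : FractionalDilate) (p : ℝ) : 0 ≤ γ.powSum p :=
  Finset.sum_nonneg fun _ _ => Real.rpow_nonneg (NNReal.coe_nonneg _) _

theorem powSum_pos {γ : FractionalDilate} (hγ : γ ≠ 0) (p : ℝ) : 0 < γ.powSum p :=
  Finset.sum_pos (fun _ hi => Real.rpow_pos_of_pos (coe_pos_of_mem hi) _)
    (Finsupp.support_nonempty_iff.2 hγ)

theorem hasDerivAt_powSum (γ : FractionalDilate) (p : ℝ) :
    HasDerivAt γ.powSum (∑ n ∈ γ.support, (γ n : ℝ) ^ p * Real.log (γ n)) p := by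
  have : γ.powSum = fun p => ∑ n ∈ γ.support, (γ n : ℝ) ^ p := rfl
  rw [this]
  refine HasDerivAt.fun_sum fun i hi => ?_
  exact (Real.hasStrictDerivAt_const_rpow (coe_pos_of_mem hi) p).hasDerivAt

theorem continuous_powSum (γ : FractionalDilate) : Continuous γ.powSum :=
  continuous_iff_continuousAt.2 fun p => (γ.hasDerivAt_powSum p).continuousAt

/-- The endpoints follow by continuity; they matter because the minimising exponent may be 0 or 1.
-/
theorem size_le_powSum_of_mem_Icc (γ : FractionalDilate) {p : ℝ} (hp : p ∈ Set.Icc (0 : ℝ) 1) :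
    γ.size ≤ γ.powSum p := by
  have hIoo : Set.Ioo (0 : ℝ) 1 ⊆ {q | γ.size ≤ γ.powSum q} := fun q hq =>
    ciInf_le (f := fun p : Set.Ioo (0 : ℝ) 1 => γ.powSum p)
      ⟨0, by rintro _ ⟨q, rfl⟩; exact γ.powSum_nonneg q⟩ ⟨q, hq⟩
  have hcl : closure (Set.Ioo (0 : ℝ) 1) ⊆ {q | γ.size ≤ γ.powSum q} :=
    closure_minimal hIoo (isClosed_le continuous_const γ.continuous_powSum)
  rw [closure_Ioo zero_ne_one] at hcl
  exact hcl hp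

theorem le_size {γ : FractionalDilate} {a : ℝ} (h : ∀ p ∈ Set.Ioo (0 : ℝ) 1, a ≤ γ.powSum p) :
    a ≤ γ.size := by
  have : Nonempty (Set.Ioo (0 : ℝ) 1) := ⟨⟨1 / 2, by norm_num⟩⟩
  exact le_ciInf fun p => h p p.2

theorem size_nonneg (γ : FractionalDilate) : 0 ≤ γ.size := le_size fun p _ => γ.powSum_nonneg p

/-- The size is attained at some exponent in the closed unit interval. -/
theorem exists_powSum_eq_size (γ : FractionalDilate) :
    ∃ p ∈ Set.Icc (0 : ℝ) 1, γ.powSum p = γ.size ∧ ∀ q ∈ Set.Icc (0 : ℝ) 1, γ.powSum p ≤ γ.powSum q := by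
  obtain ⟨p, hp, hmin⟩ := isCompact_Icc.exists_isMinOn (Set.nonempty_Icc.2 zero_le_one)
    (γ.continuous_powSum.continuousOn (s := Set.Icc (0 : ℝ) 1))
  exact ⟨p, hp, le_antisymm (le_size fun q hq => hmin (Set.Ioo_subset_Icc_self hq))
    (γ.size_le_powSum_of_mem_Icc hp), fun q hq => hmin hq⟩

/-- For every p in [0, 1] one has min(1, t) ≤ t^p; take p minimising. -/
theorem sum_min_one_weight_le (γ : FractionalDilate) (n : ℕ) :
    ∑ z ∈ γ.box n, min 1 (γ.weight z) ≤ γ.size ^ n := by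
  obtain ⟨p, hp, hps, -⟩ := γ.exists_powSum_eq_size
  rw [← hps, ← γ.sum_weight_rpow n p]
  refine Finset.sum_le_sum fun z hz => ?_
  have hw := weight_pos hz
  rcases le_total (γ.weight z) 1 with h | h
  · rw [min_eq_right h]
    simpa using Real.rpow_le_rpow_of_exponent_ge hw h hp.2
  · rw [min_eq_left h]
    exact Real.one_le_rpow h hp.1

/-- Upper tail of the tilted weights. -/
theorem exists_upper_tail_le {γ : FractionalDilate} (hγ : γ ≠ 0) {p ε : ℝ} (hp : 0 < p)
    (hmin : ∀ q ∈ Set.Ico 0 p, γ.powSum p ≤ γ.powSum q) (hε : 0 < ε) :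
    ∃ r, 0 ≤ r ∧ r < γ.powSum p ∧ ∀ n : ℕ,
      ∑ z ∈ γ.box n with Real.exp (ε * n) < γ.weight z, γ.weight z ^ p ≤ r ^ n := by
  have hd := γ.hasDerivAt_powSum p
  set d := ∑ n ∈ γ.support, (γ n : ℝ) ^ p * Real.log (γ n)
  -- Otherwise the power sum would decrease on moving left from p.
  have hd0 : d ≤ 0 := by
    by_contra! hpos
    obtain ⟨δ, h0, h1, h2⟩ := hd.exists_sub_lt hpos hp
    exact absurd (hmin (p - δ) ⟨by linarith, by linarith⟩) (not_le.2 h2)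
  have hF := powSum_pos hγ p
  have hexp : HasDerivAt (fun q => Real.exp (-ε * (q - p))) (-ε) p := by
    have := (((hasDerivAt_id p).sub_const p).const_mul (-ε)).exp
    simpa using this
  -- Chernoff bound: F(q) e^(-ε(q-p)) has derivative d - εF(p) < 0 at p, so r = F(p+δ) e^(-εδ) lies
  -- below F(p) for some δ > 0. On the tail, t > e^(εn) gives t^p ≤ t^(p+δ) e^(-εδn).
  have hg := hd.mul hexp
  simp only [sub_self, mul_zero, Real.exp_zero, mul_one] at hg
  obtain ⟨δ, h0, -, h2⟩ := hg.exists_add_lt (by nlinarith) one_pos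
  simp only [Pi.mul_apply, sub_self, mul_zero, Real.exp_zero, mul_one, add_sub_cancel_left] at h2
  refine ⟨_, mul_nonneg (γ.powSum_nonneg _) (Real.exp_pos _).le, h2, fun n => ?_⟩
  rw [mul_pow, ← γ.sum_weight_rpow, Finset.sum_mul]
  refine (Finset.sum_le_sum fun z hz => ?_).trans (Finset.sum_le_sum_of_subset_of_nonneg
    (Finset.filter_subset _ _) fun z _ _ => ?_)
  · rw [Finset.mem_filter] at hz
    have hw := weight_pos hz.1
    rw [Real.rpow_add hw, mul_assoc]
    refine le_mul_of_one_le_right (by positivity) ?_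
    rw [← Real.exp_nat_mul, ← Real.log_le_log_iff one_pos (by positivity), Real.log_one,
      Real.log_mul (by positivity) (Real.exp_pos _).ne', Real.log_rpow hw, Real.log_exp]
    have : ε * n ≤ Real.log (γ.weight z) := ((Real.lt_log_iff_exp_lt hw).2 hz.2).le
    nlinarith
  · have := γ.weight_nonneg z
    positivity

/-- Lower tail of the tilted weights. -/
theorem exists_lower_tail_le {γ : FractionalDilate} (hγ : γ ≠ 0) {p ε : ℝ} (hp : p < 1)
    (hmin : ∀ q ∈ Set.Ioc p 1, γ.powSum p ≤ γ.powSum q) (hε : 0 < ε) :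
    ∃ r, 0 ≤ r ∧ r < γ.powSum p ∧ ∀ n : ℕ,
      ∑ z ∈ γ.box n with γ.weight z < Real.exp (-(ε * n)), γ.weight z ^ p ≤ r ^ n := by
  have hd := γ.hasDerivAt_powSum p
  set d := ∑ n ∈ γ.support, (γ n : ℝ) ^ p * Real.log (γ n)
  have hd0 : 0 ≤ d := by
    by_contra! hneg
    obtain ⟨δ, h0, h1, h2⟩ := hd.exists_add_lt hneg (sub_pos.2 hp)
    exact absurd (hmin (p + δ) ⟨by linarith, by linarith⟩) (not_le.2 h2)
  have hF := powSum_pos hγ p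
  have hexp : HasDerivAt (fun q => Real.exp (ε * (q - p))) ε p := by
    have := (((hasDerivAt_id p).sub_const p).const_mul ε).exp
    simpa using this
  -- The mirror image of the upper tail: now d + εF(p) > 0, and the exponent moves down to p - δ.
  have hg := hd.mul hexp
  simp only [sub_self, mul_zero, Real.exp_zero, mul_one] at hg
  obtain ⟨δ, h0, -, h2⟩ := hg.exists_sub_lt (by nlinarith) one_pos
  simp only [Pi.mul_apply, sub_self, mul_zero, Real.exp_zero, mul_one, sub_sub_cancel_left] at h2
  refine ⟨_, mul_nonneg (γ.powSum_nonneg _) (Real.exp_pos _).le, h2, fun n => ?_⟩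
  rw [mul_pow, ← γ.sum_weight_rpow, Finset.sum_mul]
  refine (Finset.sum_le_sum fun z hz => ?_).trans (Finset.sum_le_sum_of_subset_of_nonneg
    (Finset.filter_subset _ _) fun z _ _ => ?_)
  · rw [Finset.mem_filter] at hz
    have hw := weight_pos hz.1
    rw [sub_eq_add_neg, Real.rpow_add hw, mul_assoc]
    refine le_mul_of_one_le_right (by positivity) ?_
    rw [← Real.exp_nat_mul, ← Real.log_le_log_iff one_pos (by positivity), Real.log_one,
      Real.log_mul (by positivity) (Real.exp_pos _).ne', Real.log_rpow hw, Real.log_exp]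
    have : Real.log (γ.weight z) ≤ -(ε * n) := ((Real.log_lt_iff_lt_exp hw).2 hz.2).le
    nlinarith
  · have := γ.weight_nonneg z
    positivity

/-- Each tail takes at most a quarter of F(p)ⁿ for large n; the remaining half lies where t^p ≤
e^(εn) min(1, t). -/
theorem eventually_le_sum_min_one_weight {γ : FractionalDilate} (hγ : γ ≠ 0) {ε : ℝ}
    (hε : 0 < ε) : ∀ᶠ n : ℕ in atTop,
      1 / 2 * (Real.exp (-ε) * γ.size) ^ n ≤ ∑ z ∈ γ.box n, min 1 (γ.weight z) := by
  obtain ⟨p, hp, hps, hmin⟩ := γ.exists_powSum_eq_size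
  have hF := powSum_pos hγ p
  -- At p = 0 large weights are harmless, since t^0 = 1; the clause p ≠ 0 then empties this tail.
  -- Likewise p ≠ 1 for the lower tail.
  obtain ⟨r₁, hr₁, hr₁F, h₁⟩ : ∃ r, 0 ≤ r ∧ r < γ.powSum p ∧ ∀ n : ℕ,
      ∑ z ∈ γ.box n with (p ≠ 0 ∧ Real.exp (ε * n) < γ.weight z), γ.weight z ^ p ≤ r ^ n := by
    rcases hp.1.eq_or_lt with h0 | h0
    · exact ⟨0, le_rfl, hF, fun n => by simp [← h0]⟩
    · obtain ⟨r, h⟩ := exists_upper_tail_le hγ h0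
        (fun q hq => hmin q ⟨hq.1, hq.2.le.trans hp.2⟩) hε
      exact ⟨r, by simpa [h0.ne'] using h⟩
  obtain ⟨r₂, hr₂, hr₂F, h₂⟩ : ∃ r, 0 ≤ r ∧ r < γ.powSum p ∧ ∀ n : ℕ,
      ∑ z ∈ γ.box n with (p ≠ 1 ∧ γ.weight z < Real.exp (-(ε * n))), γ.weight z ^ p ≤ r ^ n := by
    rcases hp.2.eq_or_lt with h0 | h0
    · exact ⟨0, le_rfl, hF, fun n => by simp [h0]⟩
    · obtain ⟨r, h⟩ := exists_lower_tail_le hγ h0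
        (fun q hq => hmin q ⟨hp.1.trans hq.1.le, hq.2⟩) hε
      exact ⟨r, by simpa [h0.ne] using h⟩
  have hq : ∀ {r : ℝ}, 0 ≤ r → r < γ.powSum p → ∀ᶠ n : ℕ in atTop, r ^ n ≤ 1 / 4 * γ.powSum p ^ n := by
    intro r hr hrF
    have := (isLittleO_pow_pow_of_lt_left hr hrF).bound (show (0 : ℝ) < 1 / 4 by norm_num)
    filter_upwards [this] with n hn
    simpa [abs_of_nonneg hr, abs_of_pos hF] using hn
  filter_upwards [hq hr₁ hr₁F, hq hr₂ hr₂F] with n hn₁ hn₂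
  have hpt : ∀ z ∈ γ.box n, γ.weight z ^ p
      ≤ Real.exp (ε * n) * min 1 (γ.weight z)
        + (if (p ≠ 0 ∧ Real.exp (ε * n) < γ.weight z) then γ.weight z ^ p else 0)
        + (if (p ≠ 1 ∧ γ.weight z < Real.exp (-(ε * n))) then γ.weight z ^ p else 0) := by
    intro z hz
    have hw := weight_pos hz
    have hmin0 : 0 ≤ Real.exp (ε * n) * min 1 (γ.weight z) := by positivity
    have hwp : 0 ≤ γ.weight z ^ p := by positivity
    by_cases hA : (p ≠ 0 ∧ Real.exp (ε * n) < γ.weight z)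
    · rw [if_pos hA]; split_ifs <;> linarith
    by_cases hB : (p ≠ 1 ∧ γ.weight z < Real.exp (-(ε * n)))
    · rw [if_neg hA, if_pos hB]; linarith
    rw [if_neg hA, if_neg hB, add_zero, add_zero]
    have := exp_neg_mul_rpow_le_min_one hw hp.1 hp.2 (by positivity : 0 ≤ ε * n)
      (by by_contra! h; exact hA h) (by by_contra! h; exact hB h)
    rwa [Real.exp_neg, inv_mul_le_iff₀ (Real.exp_pos _)] at this
  have hsum := Finset.sum_le_sum hpt
  rw [γ.sum_weight_rpow, Finset.sum_add_distrib, Finset.sum_add_distrib, ← Finset.mul_sum,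
    ← Finset.sum_filter, ← Finset.sum_filter] at hsum
  have h3 : 1 / 2 * γ.powSum p ^ n ≤ Real.exp (ε * n) * ∑ z ∈ γ.box n, min 1 (γ.weight z) := by
    linarith [h₁ n, h₂ n]
  rw [← hps, mul_pow, ← Real.exp_nat_mul, mul_left_comm, mul_neg, mul_comm (n : ℝ), Real.exp_neg,
    inv_mul_le_iff₀ (Real.exp_pos _)]
  exact h3

theorem IsFractionalSet.size_eq_powSum_one {α : FractionalDilate} (hα : α.IsFractionalSet) :
    α.size = α.powSum 1 := by
  refine le_antisymm (α.size_le_powSum_of_mem_Icc (by simp)) (le_size fun p hp => ?_)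
  exact Finset.sum_le_sum fun i hi =>
    Real.rpow_le_rpow_of_exponent_ge (coe_pos_of_mem hi) (hα.coe_le_one i) hp.2.le

/-- The convex power sum lies above its tangent at 1, which has negative slope, so the infimum is
its value at 1. -/
theorem IsSpartan.size_eq_powSum_one {γ : FractionalDilate} (hγ : γ.IsSpartan) :
    γ.size = γ.powSum 1 := by
  refine le_antisymm (γ.size_le_powSum_of_mem_Icc (by simp)) (le_size fun p hp => ?_)
  have h : ∀ i ∈ γ.support, (γ i : ℝ) + (p - 1) * (γ i * Real.log (γ i)) ≤ (γ i : ℝ) ^ p := by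
    intro i hi
    have h0 := coe_pos_of_mem hi
    have h1 := Real.add_one_le_exp (Real.log (γ i) * (p - 1))
    rw [← Real.rpow_def_of_pos h0, Real.rpow_sub_one h0.ne', le_div_iff₀ h0] at h1
    linarith
  have hs := Finset.sum_le_sum h
  rw [Finset.sum_add_distrib, ← Finset.mul_sum] at hs
  rw [powSum_one]
  have : 0 ≤ (p - 1) * ∑ i ∈ γ.support, (γ i * Real.log (γ i) : ℝ) :=
    mul_nonneg_of_nonpos_of_nonpos (by linarith [hp.2]) (le_of_lt hγ)
  exact (by linarith : _ ≤ _).trans hs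

/-- The spartan sum is the derivative of the power sum at 1. The exponent 1 + δ found here controls
every error term in the spartan case. -/
theorem IsSpartan.exists_powSum_lt {γ : FractionalDilate} (hγ : γ.IsSpartan) :
    ∃ δ, 0 < δ ∧ δ < 1 ∧ γ.powSum (1 + δ) < γ.powSum 1 := by
  refine (γ.hasDerivAt_powSum 1).exists_add_lt ?_ one_pos
  simpa [IsSpartan] using hγ

end FractionalDilate

/-! ### Moment inequalities for unions of events. -/

section Events

variable {Ω J : Type*} [MeasurableSpace Ω] {P : Measure Ω} [IsProbabilityMeasure P]
  {s : Finset J} {E : J → Set Ω}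

theorem integral_sum_indicator (hE : ∀ j, MeasurableSet (E j)) :
    ∫ ω, ∑ j ∈ s, (E j).indicator (1 : Ω → ℝ) ω ∂P = ∑ j ∈ s, P.real (E j) := by
  rw [integral_finsetSum (f := fun j => (E j).indicator (1 : Ω → ℝ)) _
    fun j _ => (integrable_const (1 : ℝ)).indicator (hE j)]
  exact Finset.sum_congr rfl fun j _ => integral_indicator_one (hE j)

theorem integrable_sum_indicator (hE : ∀ j, MeasurableSet (E j)) :
    Integrable (fun ω => ∑ j ∈ s, (E j).indicator (1 : Ω → ℝ) ω) P :=
  integrable_finsetSum _ fun j _ => (integrable_const (1 : ℝ)).indicator (hE j)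

/-- A pointwise inequality for the number of events that occur, in expectation. -/
theorem moments_le_measureReal_biUnion (hE : ∀ j, MeasurableSet (E j)) {a b : ℝ}
    (hab : ∀ n : ℕ, 0 < n → a * n + b * (n : ℝ) ^ 2 ≤ 1) :
    a * ∑ j ∈ s, P.real (E j) + b * ∑ j ∈ s, ∑ l ∈ s, P.real (E j ∩ E l)
      ≤ P.real (⋃ j ∈ s, E j) := by
  classical
  have hU : MeasurableSet (⋃ j ∈ s, E j) := Finset.measurableSet_biUnion _ fun j _ => hE j
  have h2 : ∀ ω, (∑ j ∈ s, (E j).indicator (1 : Ω → ℝ) ω) ^ 2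
      = ∑ j ∈ s, ∑ l ∈ s, (E j ∩ E l).indicator (1 : Ω → ℝ) ω := by
    intro ω
    rw [sq, Finset.sum_mul_sum]
    refine Finset.sum_congr rfl fun j _ => Finset.sum_congr rfl fun l _ => ?_
    rw [Set.inter_indicator_one]
    rfl
  have hint : ∀ j, Integrable (fun ω => ∑ l ∈ s, (E j ∩ E l).indicator (1 : Ω → ℝ) ω) P :=
    fun j => integrable_sum_indicator fun l => (hE j).inter (hE l)
  have hint2 := integrable_finsetSum s fun j _ => hint j
  have hX := integrable_sum_indicator (P := P) (s := s) hE
  calc _ = ∫ ω, (a * ∑ j ∈ s, (E j).indicator (1 : Ω → ℝ) ω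
        + b * ∑ j ∈ s, ∑ l ∈ s, (E j ∩ E l).indicator (1 : Ω → ℝ) ω) ∂P := by
        rw [integral_add (hX.const_mul a) (hint2.const_mul b), integral_const_mul,
          integral_const_mul, integral_sum_indicator hE, integral_finsetSum _ fun j _ => hint j]
        congr 2
        exact Finset.sum_congr rfl fun j _ =>
          (integral_sum_indicator fun l => (hE j).inter (hE l)).symm
    _ ≤ ∫ ω, (⋃ j ∈ s, E j).indicator (1 : Ω → ℝ) ω ∂P := by
        refine integral_mono ((hX.const_mul a).add (hint2.const_mul b))
          ((integrable_const (1 : ℝ)).indicator hU) fun ω => ?_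
        simp only
        rw [← h2]
        have hcard : ∑ j ∈ s, (E j).indicator (1 : Ω → ℝ) ω
            = ((s.filter fun j => ω ∈ E j).card : ℝ) := by
          simp [Set.indicator_apply]
        rw [hcard]
        by_cases hω : ω ∈ ⋃ j ∈ s, E j
        · rw [Set.indicator_of_mem hω]
          refine hab _ (Finset.card_pos.2 ?_)
          simp only [Set.mem_iUnion] at hω
          obtain ⟨j, hj, hjω⟩ := hω
          exact ⟨j, Finset.mem_filter.2 ⟨hj, hjω⟩⟩
        · rw [Set.indicator_of_notMem hω]
          have : s.filter (fun j => ω ∈ E j) = ∅ := by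
            refine Finset.filter_eq_empty_iff.2 fun j hj hjω => hω ?_
            simp only [Set.mem_iUnion]
            exact ⟨j, hj, hjω⟩
          simp [this]
    _ = _ := integral_indicator_one hU

/-- With N the number of events that occur, this integrates 2N - N² ≤ 1, that is (N - 1)² ≥ 0. -/
theorem sum_sub_measureReal_biUnion_le (hE : ∀ j, MeasurableSet (E j)) :
    ∑ j ∈ s, P.real (E j) - P.real (⋃ j ∈ s, E j)
      ≤ ∑ j ∈ s, ∑ l ∈ s, P.real (E j ∩ E l) - ∑ j ∈ s, P.real (E j) := by
  have := moments_le_measureReal_biUnion (P := P) (s := s) hE (a := 2) (b := -1)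
    fun n _ => by nlinarith [sq_nonneg ((n : ℝ) - 1)]
  linarith

/-- Here the integrand is (N - 1)(N - 2) ≥ 0 for integers N ≥ 1. Equality at N = 2 suits k = 1,
where a typical sum arises from a pair and its reversal. -/
theorem half_sum_sub_measureReal_biUnion_le (hE : ∀ j, MeasurableSet (E j)) :
    (∑ j ∈ s, P.real (E j)) / 2 - P.real (⋃ j ∈ s, E j)
      ≤ (∑ j ∈ s, ∑ l ∈ s, P.real (E j ∩ E l)) / 2 - ∑ j ∈ s, P.real (E j) := by
  have := moments_le_measureReal_biUnion (P := P) (s := s) hE (a := 3 / 2) (b := -(1 / 2))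
    fun n hn => by
      rcases Nat.eq_or_lt_of_le (Nat.succ_le_of_lt hn) with h | h
      · rw [← h]; norm_num
      · have : (2 : ℝ) ≤ n := by exact_mod_cast h
        nlinarith
  linarith

/-- Second moment bound: if the dependence among the events is bounded, then their union has
probability comparable to the truncated sum of their probabilities. -/
theorem min_one_div_four_le_measureReal_biUnion (hE : ∀ j, MeasurableSet (E j))
    (hQ : ∑ j ∈ s, ∑ l ∈ s, P.real (E j ∩ E l)
      ≤ (∑ j ∈ s, P.real (E j)) ^ 2 + 3 * ∑ j ∈ s, P.real (E j)) :
    min 1 (∑ j ∈ s, P.real (E j)) / 4 ≤ P.real (⋃ j ∈ s, E j) := by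
  have hm : 0 ≤ ∑ j ∈ s, P.real (E j) := Finset.sum_nonneg fun _ _ => measureReal_nonneg
  set m := ∑ j ∈ s, P.real (E j)
  -- The inequality is 2tN - t²N² ≤ 1; t = 1/(m + 3) maximises 2tm - t²(m² + 3m) and yields the
  -- lower bound m/(m + 3).
  have h := moments_le_measureReal_biUnion (P := P) (s := s) hE (a := 2 * (m + 3)⁻¹)
    (b := -((m + 3)⁻¹) ^ 2) fun n _ => by nlinarith [sq_nonneg ((m + 3)⁻¹ * (n : ℝ) - 1)]
  have hi : (m + 3)⁻¹ * (m + 3) = 1 := inv_mul_cancel₀ (by linarith)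
  have hi0 : 0 < (m + 3)⁻¹ := by positivity
  set t := (m + 3)⁻¹
  have h1 : t * m ≤ P.real (⋃ j ∈ s, E j) := by
    have : t ^ 2 * ∑ j ∈ s, ∑ l ∈ s, P.real (E j ∩ E l) ≤ t ^ 2 * (m ^ 2 + 3 * m) :=
      mul_le_mul_of_nonneg_left hQ (sq_nonneg t)
    have h3 : t ^ 2 * (m ^ 2 + 3 * m) = t * m * (t * (m + 3)) := by ring
    rw [h3, hi] at this
    linarith
  refine le_trans ?_ h1
  rcases le_total 1 m with h1 | h1
  · rw [min_eq_left h1]; nlinarith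
  · rw [min_eq_right h1]
    have : 1 / 4 ≤ t := by nlinarith
    nlinarith

end Events

/-! ### Fibres of (x, y) ↦ x + k y. -/

namespace FractionalDilate

/-- The pairs of points `(x, y)` of the supports of `αⁿ` and `βⁿ`, as vectors of pairs. -/
def pairBox (α β : FractionalDilate) (n : ℕ) : Finset (Fin n → ℤ × ℤ) :=
  Fintype.piFinset fun _ => α.support ×ˢ β.support

end FractionalDilate

/-- The first component of a vector of pairs. -/
def fstVec {n : ℕ} (w : Fin n → ℤ × ℤ) : Fin n → ℤ := fun i => (w i).1

/-- The second component of a vector of pairs. -/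
def sndVec {n : ℕ} (w : Fin n → ℤ × ℤ) : Fin n → ℤ := fun i => (w i).2

theorem vec_ext {n : ℕ} {w u : Fin n → ℤ × ℤ} (h1 : fstVec w = fstVec u)
    (h2 : sndVec w = sndVec u) : w = u :=
  funext fun i => Prod.ext (congrFun h1 i) (congrFun h2 i)

/-- The value `x + k y` of a pair. -/
def vecSum {n : ℕ} (k : ℤ) (w : Fin n → ℤ × ℤ) : Fin n → ℤ := fstVec w + k • sndVec w

namespace FractionalDilate

/-- The pairs `(x, y)` with `x + k y = z`. -/
def edges (α : FractionalDilate) (k : ℤ) (β : FractionalDilate) {n : ℕ} (z : Fin n → ℤ) :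
    Finset (Fin n → ℤ × ℤ) :=
  (pairBox α β n).filter fun w => vecSum k w = z

variable {α β : FractionalDilate} {k : ℤ} {n : ℕ}

theorem mem_box {γ : FractionalDilate} {z : Fin n → ℤ} : z ∈ γ.box n ↔ ∀ i, z i ∈ γ.support :=
  Fintype.mem_piFinset

theorem mem_pairBox {w : Fin n → ℤ × ℤ} :
    w ∈ pairBox α β n ↔ fstVec w ∈ α.box n ∧ sndVec w ∈ β.box n := by
  simp only [pairBox, Fintype.mem_piFinset, Finset.mem_product, mem_box, fstVec, sndVec,
    forall_and]

theorem mem_edges {z : Fin n → ℤ} {w : Fin n → ℤ × ℤ} :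
    w ∈ edges α k β z ↔ w ∈ pairBox α β n ∧ vecSum k w = z := Finset.mem_filter

theorem add_mem_support_addDilate {i j : ℤ} (hi : i ∈ α.support) (hj : j ∈ β.support) :
    i + k * j ∈ (addDilate α k β).support := by
  rw [Finsupp.mem_support_iff, addDilate_apply]
  refine (Finset.sum_pos' (fun _ _ => zero_le) ⟨(i, j), ?_, ?_⟩).ne'
  · simp only [Finset.mem_filter, Finset.mem_product]
    exact ⟨⟨hi, hj⟩, trivial⟩
  · exact mul_pos (pos_iff_ne_zero.2 (Finsupp.mem_support_iff.1 hi))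
      (pos_iff_ne_zero.2 (Finsupp.mem_support_iff.1 hj))

theorem vecSum_mem_box {w : Fin n → ℤ × ℤ} (hw : w ∈ pairBox α β n) :
    vecSum k w ∈ (addDilate α k β).box n := by
  rw [mem_pairBox, mem_box, mem_box] at hw
  exact mem_box.2 fun i => add_mem_support_addDilate (hw.1 i) (hw.2 i)

theorem sum_edges (f : (Fin n → ℤ × ℤ) → ℝ) :
    ∑ z ∈ (addDilate α k β).box n, ∑ w ∈ edges α k β z, f w = ∑ w ∈ pairBox α β n, f w :=
  Finset.sum_fiberwise_of_maps_to (fun _ hw => vecSum_mem_box hw) f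

theorem sum_pairBox_prod (g : ℤ × ℤ → ℝ) :
    ∑ w ∈ pairBox α β n, ∏ i, g (w i) = (∑ q ∈ α.support ×ˢ β.support, g q) ^ n := by
  have h : (∑ q ∈ α.support ×ˢ β.support, g q) ^ n
      = ∏ _i : Fin n, ∑ q ∈ α.support ×ˢ β.support, g q := by simp
  rw [h, Finset.prod_univ_sum, pairBox]

theorem edges_eq_piFinset (z : Fin n → ℤ) :
    edges α k β z = Fintype.piFinset fun i =>
      (α.support ×ˢ β.support).filter fun q => q.1 + k * q.2 = z i := by
  ext w
  simp only [mem_edges, pairBox, Fintype.mem_piFinset, Finset.mem_filter, forall_and,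
    funext_iff]
  rfl

/-- A fibre is a product of one-coordinate fibres, so the sum factors. -/
theorem sum_edges_weight (z : Fin n → ℤ) :
    ∑ w ∈ edges α k β z, α.weight (fstVec w) * β.weight (sndVec w)
      = (addDilate α k β).weight z := by
  have h : (addDilate α k β).weight z = ∏ i, ∑ q ∈ (α.support ×ˢ β.support).filter
      (fun q => q.1 + k * q.2 = z i), ((α q.1 : ℝ) * (β q.2 : ℝ)) := by
    refine Finset.prod_congr rfl fun i _ => ?_
    rw [addDilate_apply]
    push_cast
    rfl
  rw [h, Finset.prod_univ_sum, ← edges_eq_piFinset]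
  exact Finset.sum_congr rfl fun w _ => Finset.prod_mul_distrib.symm

theorem powSum_one_addDilate :
    (addDilate α k β).powSum 1 = α.powSum 1 * β.powSum 1 := by
  -- The one-dimensional identity is the case n = 1 of the fibre decomposition.
  have h := sum_weight (addDilate α k β) 1
  simp_rw [← sum_edges_weight (α := α) (β := β) (k := k)] at h
  rw [sum_edges, pow_one] at h
  rw [← h]
  have := sum_pairBox_prod (α := α) (β := β) (n := 1) fun q => (α q.1 : ℝ) * (β q.2 : ℝ)
  simp only [Finset.univ_unique, Finset.prod_singleton, pow_one] at this
  simp only [weight, Finset.univ_unique, Finset.prod_singleton, fstVec, sndVec]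
  rw [this, Finset.sum_product, powSum_one, powSum_one, Finset.sum_mul_sum]

/-- Cancelling x leaves k y = k y', and k ≠ 0. With `edges_ext_snd` this is the source of
independence inside a fibre. -/
theorem edges_ext_fst (hk : k ≠ 0) {z : Fin n → ℤ} {w u : Fin n → ℤ × ℤ}
    (hw : w ∈ edges α k β z) (hu : u ∈ edges α k β z) (h : fstVec w = fstVec u) : w = u := by
  have h1 := (mem_edges.1 hw).2.trans (mem_edges.1 hu).2.symm
  rw [vecSum, vecSum, h] at h1
  exact vec_ext h (smul_right_injective _ hk (add_left_cancel h1))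

theorem edges_ext_snd {z : Fin n → ℤ} {w u : Fin n → ℤ × ℤ}
    (hw : w ∈ edges α k β z) (hu : u ∈ edges α k β z) (h : sndVec w = sndVec u) : w = u := by
  have h1 := (mem_edges.1 hw).2.trans (mem_edges.1 hu).2.symm
  rw [vecSum, vecSum, h] at h1
  exact vec_ext (add_right_cancel h1) h

end FractionalDilate

/-! ### Cardinalities as sums of indicators, and their expectations. -/

open FractionalDilate

/-- The event that both components of a pair are drawn. -/
def hit {Ω : Type*} {n : ℕ} (S T : Ω → Set (Fin n → ℤ)) (w : Fin n → ℤ × ℤ) : Set Ω :=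
  {ω | fstVec w ∈ S ω ∧ sndVec w ∈ T ω}

section Counting

variable {Ω : Type*} {n : ℕ} {S T : Ω → Set (Fin n → ℤ)} {α β : FractionalDilate}

theorem ncard_eq_sum_indicator {ω : Ω} (h : S ω ⊆ ↑(α.box n)) :
    ((S ω).ncard : ℝ) = ∑ x ∈ α.box n, {ω | x ∈ S ω}.indicator (1 : Ω → ℝ) ω := by
  classical
  have : S ω = ↑((α.box n).filter fun x => x ∈ S ω) := by
    ext x
    simp only [Finset.coe_filter, Set.mem_ofPred_eq]
    exact ⟨fun hx => ⟨h hx, hx⟩, fun hx => hx.2⟩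
  rw [this, Set.ncard_coe_finset]
  simp [Set.indicator_apply]

theorem ncard_sumDilate_eq_sum_indicator (k : ℤ) {ω : Ω} (hS : S ω ⊆ ↑(α.box n))
    (hT : T ω ⊆ ↑(β.box n)) :
    ((sumDilate (S ω) k (T ω)).ncard : ℝ) = ∑ z ∈ (addDilate α k β).box n,
      (⋃ w ∈ edges α k β z, hit S T w).indicator (1 : Ω → ℝ) ω := by
  have hiff : ∀ z, z ∈ sumDilate (S ω) k (T ω) ↔ ω ∈ ⋃ w ∈ edges α k β z, hit S T w := by
    intro z
    simp only [sumDilate, Set.mem_image2, Set.mem_iUnion, mem_edges, mem_pairBox, hit,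
      Set.mem_ofPred_eq, exists_prop]
    constructor
    · rintro ⟨x, hx, y, hy, rfl⟩
      exact ⟨fun i => (x i, y i), ⟨⟨hS hx, hT hy⟩, rfl⟩, hx, hy⟩
    · rintro ⟨w, ⟨-, rfl⟩, hx, hy⟩
      exact ⟨_, hx, _, hy, rfl⟩
  have hsub : sumDilate (S ω) k (T ω) ⊆ ↑((addDilate α k β).box n) := by
    intro z hz
    have := (hiff z).1 hz
    simp only [Set.mem_iUnion, exists_prop] at this
    obtain ⟨w, hw, -⟩ := this
    rw [mem_edges] at hw
    rw [← hw.2]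
    exact vecSum_mem_box hw.1
  rw [ncard_eq_sum_indicator (S := fun ω => sumDilate (S ω) k (T ω)) hsub]
  refine Finset.sum_congr rfl fun z _ => ?_
  by_cases h : z ∈ sumDilate (S ω) k (T ω)
  · rw [Set.indicator_of_mem ((hiff z).1 h), Set.indicator_of_mem (by exact h)]
  · rw [Set.indicator_of_notMem (mt (hiff z).2 h), Set.indicator_of_notMem (by exact h)]

theorem ncard_mul_ncard_eq_sum_indicator {ω : Ω} (hS : S ω ⊆ ↑(α.box n))
    (hT : T ω ⊆ ↑(β.box n)) :
    ((S ω).ncard : ℝ) * ((T ω).ncard : ℝ)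
      = ∑ w ∈ pairBox α β n, (hit S T w).indicator (1 : Ω → ℝ) ω := by
  rw [ncard_eq_sum_indicator hS, ncard_eq_sum_indicator hT, Finset.sum_mul_sum,
    ← Finset.sum_product']
  refine Finset.sum_nbij' (fun q i => (q.1 i, q.2 i)) (fun w => (fstVec w, sndVec w)) ?_ ?_
    (fun _ _ => rfl) (fun _ _ => rfl) ?_
  · intro q hq
    rw [Finset.mem_product] at hq
    exact mem_pairBox.2 hq
  · intro w hw
    exact Finset.mem_product.2 (mem_pairBox.1 hw)
  · intro q _
    have : hit S T (fun i => (q.1 i, q.2 i)) = {ω | q.1 ∈ S ω} ∩ {ω | q.2 ∈ T ω} := rfl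
    rw [this, Set.inter_indicator_one]
    rfl

end Counting

section RandomSets

variable {Ω : Type*} [MeasurableSpace Ω] {P : Measure Ω} {n : ℕ}
  {S T : Ω → Set (Fin n → ℤ)} {α β : FractionalDilate}

theorem measurableSet_mem_of_measurable (hS : Measurable S) (x : Fin n → ℤ) :
    MeasurableSet {ω | x ∈ S ω} :=
  measurableSet_setOfPred.2 ((measurable_set_mem x).comp hS)

theorem measurableSet_hit (hS : Measurable S) (hT : Measurable T) (w : Fin n → ℤ × ℤ) :
    MeasurableSet (hit S T w) :=
  (measurableSet_mem_of_measurable hS _).inter (measurableSet_mem_of_measurable hT _)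

theorem IsDrawnFrom.real_prob (hS : IsDrawnFrom P S α) (x : Fin n → ℤ) :
    P.real {ω | x ∈ S ω} = α.weight x := by
  rw [Measure.real, hS.prob, ENNReal.toReal_prod]
  rfl

/-- Each point outside the box has probability zero and ℤⁿ is countable. -/
theorem IsDrawnFrom.ae_subset_box (hS : IsDrawnFrom P S α) : ∀ᵐ ω ∂P, S ω ⊆ ↑(α.box n) := by
  have h : ∀ᵐ ω ∂P, ∀ x : Fin n → ℤ, x ∉ α.box n → x ∉ S ω := by
    rw [ae_all_iff]
    intro x
    by_cases hx : x ∈ α.box n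
    · exact ae_of_all _ fun ω h => absurd hx h
    · rw [mem_box] at hx
      push Not at hx
      obtain ⟨i, hi⟩ := hx
      have h0 : P {ω | x ∈ S ω} = 0 := by
        rw [hS.prob]
        refine Finset.prod_eq_zero (Finset.mem_univ i) ?_
        rw [Finsupp.notMem_support_iff.1 hi]
        rfl
      filter_upwards [measure_eq_zero_iff_ae_notMem.1 h0] with ω hω _
      exact hω
  filter_upwards [h] with ω hω x hx
  by_contra hxb
  exact hω x hxb hx

variable [IsProbabilityMeasure P]

theorem integral_ncard (hS : IsDrawnFrom P S α) :
    ∫ ω, ((S ω).ncard : ℝ) ∂P = α.powSum 1 ^ n := by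
  rw [← α.sum_weight n]
  rw [integral_congr_ae (hS.ae_subset_box.mono fun ω h => ncard_eq_sum_indicator h),
    integral_sum_indicator (measurableSet_mem_of_measurable hS.measurable)]
  exact Finset.sum_congr rfl fun x _ => hS.real_prob x

theorem integrable_ncard (hS : IsDrawnFrom P S α) :
    Integrable (fun ω => ((S ω).ncard : ℝ)) P :=
  (integrable_sum_indicator (measurableSet_mem_of_measurable hS.measurable)).congr
    (hS.ae_subset_box.mono fun _ h => (ncard_eq_sum_indicator h).symm)

theorem measurableSet_biUnion_hit (hS : Measurable S) (hT : Measurable T)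
    (s : Finset (Fin n → ℤ × ℤ)) : MeasurableSet (⋃ w ∈ s, hit S T w) :=
  Finset.measurableSet_biUnion _ fun w _ => measurableSet_hit hS hT w

theorem integral_ncard_sumDilate (hS : IsDrawnFrom P S α) (hT : IsDrawnFrom P T β) (k : ℤ) :
    ∫ ω, ((sumDilate (S ω) k (T ω)).ncard : ℝ) ∂P
      = ∑ z ∈ (addDilate α k β).box n, P.real (⋃ w ∈ edges α k β z, hit S T w) := by
  rw [← integral_sum_indicator fun z => measurableSet_biUnion_hit hS.measurable hT.measurable _]
  refine integral_congr_ae ?_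
  filter_upwards [hS.ae_subset_box, hT.ae_subset_box] with ω h1 h2
  exact ncard_sumDilate_eq_sum_indicator k h1 h2

theorem integrable_ncard_sumDilate (hS : IsDrawnFrom P S α) (hT : IsDrawnFrom P T β) (k : ℤ) :
    Integrable (fun ω => ((sumDilate (S ω) k (T ω)).ncard : ℝ)) P := by
  refine (integrable_sum_indicator (s := (addDilate α k β).box n) fun z =>
    measurableSet_biUnion_hit hS.measurable hT.measurable (edges α k β z)).congr ?_
  filter_upwards [hS.ae_subset_box, hT.ae_subset_box] with ω h1 h2
  exact (ncard_sumDilate_eq_sum_indicator k h1 h2).symm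

theorem integral_ncard_mul_ncard (hS : IsDrawnFrom P S α) (hT : IsDrawnFrom P T β) :
    ∫ ω, ((S ω).ncard : ℝ) * ((T ω).ncard : ℝ) ∂P
      = ∑ w ∈ pairBox α β n, P.real (hit S T w) := by
  rw [← integral_sum_indicator (measurableSet_hit hS.measurable hT.measurable)]
  refine integral_congr_ae ?_
  filter_upwards [hS.ae_subset_box, hT.ae_subset_box] with ω h1 h2
  exact ncard_mul_ncard_eq_sum_indicator h1 h2

theorem integrable_ncard_mul_ncard (hS : IsDrawnFrom P S α) (hT : IsDrawnFrom P T β) :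
    Integrable (fun ω => ((S ω).ncard : ℝ) * ((T ω).ncard : ℝ)) P := by
  refine (integrable_sum_indicator (s := pairBox α β n)
    (measurableSet_hit hS.measurable hT.measurable)).congr ?_
  filter_upwards [hS.ae_subset_box, hT.ae_subset_box] with ω h1 h2
  exact (ncard_mul_ncard_eq_sum_indicator h1 h2).symm

/-- A multiple of the number of pairs minus the number of sums, in expectation. -/
theorem integral_mul_sub_ncard_sumDilate (hS : IsDrawnFrom P S α) (hT : IsDrawnFrom P T β)
    (k : ℤ) (c : ℝ) :
    ∫ ω, (c * (((S ω).ncard : ℝ) * ((T ω).ncard : ℝ))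
        - ((sumDilate (S ω) k (T ω)).ncard : ℝ)) ∂P
      = ∑ z ∈ (addDilate α k β).box n, (c * ∑ w ∈ edges α k β z, P.real (hit S T w)
          - P.real (⋃ w ∈ edges α k β z, hit S T w)) := by
  rw [integral_sub ((integrable_ncard_mul_ncard hS hT).const_mul c)
    (integrable_ncard_sumDilate hS hT k), integral_const_mul, integral_ncard_mul_ncard hS hT,
    integral_ncard_sumDilate hS hT, Finset.sum_sub_distrib, ← Finset.mul_sum, sum_edges]

end RandomSets

theorem Asymptotics.IsLittleO.of_abs_le {f g : ℕ → ℝ} {G : ℝ} (h : ∀ n, |f n| ≤ g n)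
    (hg : g =o[atTop] fun n : ℕ => G ^ n) : f =o[atTop] fun n : ℕ => G ^ n := by
  refine IsBigO.trans_isLittleO (IsBigO.of_bound 1 (Eventually.of_forall fun n => ?_)) hg
  rw [one_mul, Real.norm_eq_abs, Real.norm_eq_abs]
  exact (h n).trans (le_abs_self _)

theorem sum_sum_le_sq_add {J : Type*} {s : Finset J} {p : J → ℝ} {Q r : J → J → ℝ}
    (h : ∀ w ∈ s, ∀ u ∈ s, Q w u ≤ p w * p u + r w u) :
    ∑ w ∈ s, ∑ u ∈ s, Q w u ≤ (∑ w ∈ s, p w) ^ 2 + ∑ w ∈ s, ∑ u ∈ s, r w u := by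
  rw [sq, Finset.sum_mul_sum, ← Finset.sum_add_distrib]
  refine Finset.sum_le_sum fun w hw => ?_
  rw [← Finset.sum_add_distrib]
  exact Finset.sum_le_sum fun u hu => h w hw u hu

theorem sq_le_rpow_one_add {g δ : ℝ} (h0 : 0 < g) (h1 : g ≤ 1) (hδ : δ ≤ 1) :
    g ^ 2 ≤ g ^ (1 + δ) := by
  rw [← Real.rpow_natCast]
  exact Real.rpow_le_rpow_of_exponent_ge h0 h1 (by push_cast; linarith)

theorem self_le_rpow_one_add {g δ : ℝ} (h1 : 1 ≤ g) (hδ : 0 ≤ δ) : g ≤ g ^ (1 + δ) :=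
  Real.self_le_rpow_of_one_le h1 (by linarith)

/-! ### Two independent random sets. -/

section RandomSets

variable {Ω : Type*} [MeasurableSpace Ω] {P : Measure Ω} {n : ℕ}
  {S T : Ω → Set (Fin n → ℤ)} {α β : FractionalDilate} {k : ℤ}

theorem IsDrawnFrom.real_prob_finset (hS : IsDrawnFrom P S α) (F : Finset (Fin n → ℤ)) :
    P.real {ω | ∀ x ∈ F, x ∈ S ω} = ∏ x ∈ F, α.weight x := by
  have h : {ω | ∀ x ∈ F, x ∈ S ω} = ⋂ x ∈ F, {ω | x ∈ S ω} := by
    ext ω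
    simp
  rw [h, Measure.real, hS.indep.meas_biInter, ENNReal.toReal_prod]
  exact Finset.prod_congr rfl fun x _ => hS.real_prob x

theorem IsDrawnFrom.real_prob_pair (hS : IsDrawnFrom P S α) {x y : Fin n → ℤ} (h : x ≠ y) :
    P.real {ω | x ∈ S ω ∧ y ∈ S ω} = α.weight x * α.weight y := by
  classical
  have := hS.real_prob_finset {x, y}
  rw [Finset.prod_pair h] at this
  rw [← this]
  congr 1
  ext ω
  simp

theorem real_inter_of_indepFun (hST : IndepFun S T P) {s t : Set (Set (Fin n → ℤ))}
    (hs : MeasurableSet s) (ht : MeasurableSet t) :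
    P.real {ω | S ω ∈ s ∧ T ω ∈ t} = P.real {ω | S ω ∈ s} * P.real {ω | T ω ∈ t} := by
  rw [Measure.real, Measure.real, Measure.real, ← ENNReal.toReal_mul]
  exact congrArg _ (hST.measure_inter_preimage_eq_mul s t hs ht)

theorem measurableSet_setOf_mem (x : Fin n → ℤ) :
    MeasurableSet {A : Set (Fin n → ℤ) | x ∈ A} :=
  measurableSet_setOfPred.2 (measurable_set_mem x)

theorem real_hit_of_indepFun (hS : IsDrawnFrom P S α) (hT : IsDrawnFrom P T β)
    (hST : IndepFun S T P) (w : Fin n → ℤ × ℤ) :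
    P.real (hit S T w) = α.weight (fstVec w) * β.weight (sndVec w) := by
  rw [← hS.real_prob, ← hT.real_prob]
  exact real_inter_of_indepFun hST (measurableSet_setOf_mem _) (measurableSet_setOf_mem _)

theorem real_hit_inter_hit_of_indepFun (hS : IsDrawnFrom P S α) (hT : IsDrawnFrom P T β)
    (hST : IndepFun S T P) {w u : Fin n → ℤ × ℤ} (h1 : fstVec w ≠ fstVec u)
    (h2 : sndVec w ≠ sndVec u) :
    P.real (hit S T w ∩ hit S T u) = P.real (hit S T w) * P.real (hit S T u) := by
  have h : hit S T w ∩ hit S T u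
      = {ω | S ω ∈ {A | fstVec w ∈ A} ∩ {A | fstVec u ∈ A} ∧
          T ω ∈ {A | sndVec w ∈ A} ∩ {A | sndVec u ∈ A}} := by
    ext ω
    simp only [hit, Set.mem_inter_iff, Set.mem_ofPred_eq]
    tauto
  rw [h, real_inter_of_indepFun hST
    ((measurableSet_setOf_mem _).inter (measurableSet_setOf_mem _))
    ((measurableSet_setOf_mem _).inter (measurableSet_setOf_mem _)),
    real_hit_of_indepFun hS hT hST, real_hit_of_indepFun hS hT hST]
  have e1 : P.real {ω | S ω ∈ {A | fstVec w ∈ A} ∩ {A | fstVec u ∈ A}}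
      = α.weight (fstVec w) * α.weight (fstVec u) := hS.real_prob_pair h1
  have e2 : P.real {ω | T ω ∈ {A | sndVec w ∈ A} ∩ {A | sndVec u ∈ A}}
      = β.weight (sndVec w) * β.weight (sndVec u) := hT.real_prob_pair h2
  rw [e1, e2]
  ring

theorem sum_real_hit_of_indepFun (hS : IsDrawnFrom P S α) (hT : IsDrawnFrom P T β)
    (hST : IndepFun S T P) (z : Fin n → ℤ) :
    ∑ w ∈ edges α k β z, P.real (hit S T w) = (addDilate α k β).weight z := by
  rw [← sum_edges_weight]
  exact Finset.sum_congr rfl fun w _ => real_hit_of_indepFun hS hT hST w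

/-- Distinct pairs in a fibre differ in both coordinates, so only the terms w = u exceed the product
of probabilities. -/
theorem sum_sum_real_hit_of_indepFun_le (hk : k ≠ 0) (hS : IsDrawnFrom P S α)
    (hT : IsDrawnFrom P T β) (hST : IndepFun S T P) (z : Fin n → ℤ) :
    ∑ w ∈ edges α k β z, ∑ u ∈ edges α k β z, P.real (hit S T w ∩ hit S T u)
      ≤ (addDilate α k β).weight z ^ 2 + (addDilate α k β).weight z := by
  classical
  have h : ∀ w ∈ edges α k β z, ∀ u ∈ edges α k β z, P.real (hit S T w ∩ hit S T u)
      ≤ P.real (hit S T w) * P.real (hit S T u) + if w = u then P.real (hit S T w) else 0 := by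
    intro w hw u hu
    by_cases hwu : w = u
    · subst hwu
      simp only [Set.inter_self, if_true]
      nlinarith [sq_nonneg (P.real (hit S T w))]
    · rw [if_neg hwu, add_zero, real_hit_inter_hit_of_indepFun hS hT hST
        (fun h => hwu (edges_ext_fst hk hw hu h)) fun h => hwu (edges_ext_snd hw hu h)]
  refine (sum_sum_le_sq_add h).trans (le_of_eq ?_)
  rw [sum_real_hit_of_indepFun hS hT hST]
  congr 1
  rw [← sum_real_hit_of_indepFun hS hT hST]
  exact Finset.sum_congr rfl fun w hw => by rw [Finset.sum_ite_eq, if_pos hw]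

variable [IsProbabilityMeasure P]

theorem sum_min_one_weight_le_integral_of_indepFun (hk : k ≠ 0) (hS : IsDrawnFrom P S α)
    (hT : IsDrawnFrom P T β) (hST : IndepFun S T P) :
    (∑ z ∈ (addDilate α k β).box n, min 1 ((addDilate α k β).weight z)) / 4
      ≤ ∫ ω, ((sumDilate (S ω) k (T ω)).ncard : ℝ) ∂P := by
  rw [integral_ncard_sumDilate hS hT, Finset.sum_div]
  refine Finset.sum_le_sum fun z _ => ?_
  rw [← sum_real_hit_of_indepFun hS hT hST]
  refine min_one_div_four_le_measureReal_biUnion (measurableSet_hit hS.measurable hT.measurable) ?_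
  rw [sum_real_hit_of_indepFun hS hT hST]
  have := (addDilate α k β).weight_nonneg z
  exact (sum_sum_real_hit_of_indepFun_le hk hS hT hST z).trans (by linarith)

theorem integral_le_size_pow_of_indepFun (hS : IsDrawnFrom P S α)
    (hT : IsDrawnFrom P T β) (hST : IndepFun S T P) :
    ∫ ω, ((sumDilate (S ω) k (T ω)).ncard : ℝ) ∂P ≤ (addDilate α k β).size ^ n := by
  rw [integral_ncard_sumDilate hS hT]
  refine (Finset.sum_le_sum fun z _ => ?_).trans (sum_min_one_weight_le _ n)
  rw [← sum_real_hit_of_indepFun hS hT hST]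
  exact le_min measureReal_le_one (measureReal_biUnion_finset_le _ _)

/-- With g the weight of z, the loss at z is at most g² by second moments and at most g trivially;
both cases fit under g^(1+δ). -/
theorem abs_integral_sub_le_of_indepFun (hk : k ≠ 0) (hS : IsDrawnFrom P S α)
    (hT : IsDrawnFrom P T β) (hST : IndepFun S T P) {δ : ℝ} (hδ : 0 < δ) (hδ1 : δ < 1) :
    |∫ ω, (((S ω).ncard : ℝ) * ((T ω).ncard : ℝ)
        - ((sumDilate (S ω) k (T ω)).ncard : ℝ)) ∂P| ≤ (addDilate α k β).powSum (1 + δ) ^ n := by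
  have h := integral_mul_sub_ncard_sumDilate hS hT k 1
  simp only [one_mul] at h
  rw [h, ← sum_weight_rpow]
  refine (Finset.abs_sum_le_sum_abs _ _).trans (Finset.sum_le_sum fun z hz => ?_)
  have hz0 := weight_pos hz
  rw [abs_of_nonneg (sub_nonneg.2 (measureReal_biUnion_finset_le _ _))]
  rcases le_total ((addDilate α k β).weight z) 1 with h1 | h1
  · refine le_trans ?_ (sq_le_rpow_one_add hz0 h1 hδ1.le)
    have h2 := sum_sub_measureReal_biUnion_le (P := P) (s := edges α k β z)
      (measurableSet_hit hS.measurable hT.measurable)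
    have h3 := sum_sum_real_hit_of_indepFun_le hk hS hT hST z
    rw [sum_real_hit_of_indepFun hS hT hST] at h2 ⊢
    linarith
  · refine le_trans ?_ (self_le_rpow_one_add h1 hδ.le)
    rw [sum_real_hit_of_indepFun hS hT hST]
    linarith [measureReal_nonneg (μ := P) (s := ⋃ w ∈ edges α k β z, hit S T w)]

end RandomSets

/-- A sequence comparable to the truncated weight sums grows like the powers of the size. -/
theorem tendsto_rpow_one_div_of_sum_min_one_weight {γ : FractionalDilate} {u : ℕ → ℝ} {C : ℝ}
    (hC : 0 < C) (hu : ∀ n, 0 ≤ u n) (hup : ∀ n, u n ≤ C * γ.size ^ n)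
    (hlow : ∀ n, (∑ z ∈ γ.box n, min 1 (γ.weight z)) / 4 ≤ u n) :
    Tendsto (fun n : ℕ => u n ^ (1 / (n : ℝ))) atTop (𝓝 γ.size) := by
  refine tendsto_rpow_one_div_of_bounds γ.size_nonneg hu hC hup fun ε hε => ?_
  refine ⟨1 / 8, by norm_num, ?_⟩
  by_cases hγ : γ = 0
  · have h0 : γ.size = 0 := by
      refine le_antisymm ?_ γ.size_nonneg
      simpa [hγ, powSum] using γ.size_le_powSum_of_mem_Icc (p := 1) (by simp)
    filter_upwards [eventually_ne_atTop 0] with n hn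
    simpa [h0, hn] using hu n
  · filter_upwards [eventually_le_sum_min_one_weight hγ hε] with n hn
    linarith [hlow n]

theorem sum_ite_le_of_unique {J : Type*} {s : Finset J} {p : J → Prop} [DecidablePred p]
    {f : J → ℝ} {c : ℝ} (hc : 0 ≤ c) (huniq : ∀ w ∈ s, ∀ u ∈ s, p w → p u → w = u)
    (hf : ∀ w ∈ s, p w → f w ≤ c) : ∑ w ∈ s, (if p w then f w else 0) ≤ c := by
  by_cases h : ∃ w ∈ s, p w
  · obtain ⟨w, hw, hpw⟩ := h
    rw [Finset.sum_eq_single_of_mem w hw fun u hu huw =>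
      if_neg fun hpu => huw (huniq u hu w hw hpu hpw), if_pos hpw]
    exact hf w hw hpw
  · push Not at h
    rw [Finset.sum_eq_zero fun w hw => if_neg (h w hw)]
    exact hc

/-! ### Diagonal and chain weights for a single random set. -/

namespace FractionalDilate

/-- The weight of a pair: the product of the weights of its components. -/
noncomputable def pairWeight (α : FractionalDilate) {n : ℕ} (w : Fin n → ℤ × ℤ) : ℝ :=
  α.weight (fstVec w) * α.weight (sndVec w)

/-- The weight of the common component of a diagonal pair, zero for other pairs. -/
noncomputable def diagWeight (α : FractionalDilate) {n : ℕ} (w : Fin n → ℤ × ℤ) : ℝ :=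
  ∏ i, if (w i).1 = (w i).2 then (α (w i).1 : ℝ) else 0

/-- The joint weight of a pair `(x, y)` and of the point `x + k y - k x` which forms, with `x`, a
pair of the same value. -/
noncomputable def chainWeight (α : FractionalDilate) (k : ℤ) {n : ℕ} (w : Fin n → ℤ × ℤ) : ℝ :=
  ∏ i, (α (w i).1 * α (w i).2 * α ((w i).1 + k * (w i).2 - k * (w i).1) : ℝ)

variable {α : FractionalDilate} {k : ℤ} {n : ℕ}

theorem pairWeight_nonneg (α : FractionalDilate) (w : Fin n → ℤ × ℤ) : 0 ≤ α.pairWeight w :=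
  mul_nonneg (weight_nonneg _ _) (weight_nonneg _ _)

theorem diagWeight_of_eq {w : Fin n → ℤ × ℤ} (h : fstVec w = sndVec w) :
    α.diagWeight w = α.weight (fstVec w) :=
  Finset.prod_congr rfl fun i _ => if_pos (congrFun h i)

theorem diagWeight_of_ne {w : Fin n → ℤ × ℤ} (h : fstVec w ≠ sndVec w) : α.diagWeight w = 0 := by
  obtain ⟨i, hi⟩ := Function.ne_iff.1 h
  exact Finset.prod_eq_zero (Finset.mem_univ i) (if_neg hi)

theorem diagWeight_nonneg (α : FractionalDilate) (w : Fin n → ℤ × ℤ) : 0 ≤ α.diagWeight w :=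
  Finset.prod_nonneg fun _ _ => by split_ifs <;> positivity

theorem chainWeight_nonneg (w : Fin n → ℤ × ℤ) : 0 ≤ α.chainWeight k w :=
  Finset.prod_nonneg fun _ _ => by positivity

theorem chainWeight_eq (w : Fin n → ℤ × ℤ) :
    α.chainWeight k w = α.pairWeight w * α.weight (vecSum k w - k • fstVec w) := by
  simp only [chainWeight, pairWeight, weight, ← Finset.prod_mul_distrib]
  rfl

theorem sum_edges_pairWeight (z : Fin n → ℤ) :
    ∑ w ∈ edges α k α z, α.pairWeight w = (addDilate α k α).weight z :=
  sum_edges_weight z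

theorem sum_diagWeight : ∑ w ∈ pairBox α α n, α.diagWeight w = α.powSum 1 ^ n := by
  have h : α.powSum 1
      = ∑ q ∈ α.support ×ˢ α.support, if q.1 = q.2 then (α q.1 : ℝ) else 0 := by
    rw [powSum_one, Finset.sum_product]
    exact Finset.sum_congr rfl fun i hi => by rw [Finset.sum_ite_eq, if_pos hi]
  rw [h]
  exact sum_pairBox_prod fun q => if q.1 = q.2 then (α q.1 : ℝ) else 0

/-- The total interaction of diagonal pairs with their fibres factors over coordinates, so comparing
growth rates reduces to dimension one. -/
theorem sum_edges_diagWeight_mul_weight :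
    ∑ z ∈ (addDilate α k α).box n, (∑ w ∈ edges α k α z, α.diagWeight w)
        * (addDilate α k α).weight z
      = (∑ i ∈ α.support, (α i * addDilate α k α (i + k * i) : ℝ)) ^ n := by
  have h1 : ∀ z ∈ (addDilate α k α).box n, (∑ w ∈ edges α k α z, α.diagWeight w)
      * (addDilate α k α).weight z
      = ∑ w ∈ edges α k α z, α.diagWeight w * (addDilate α k α).weight (vecSum k w) := by
    intro z _
    rw [Finset.sum_mul]
    exact Finset.sum_congr rfl fun w hw => by rw [(mem_edges.1 hw).2]
  have h2 : ∑ i ∈ α.support, (α i * addDilate α k α (i + k * i) : ℝ)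
      = ∑ q ∈ α.support ×ˢ α.support,
        (if q.1 = q.2 then (α q.1 : ℝ) else 0) * addDilate α k α (q.1 + k * q.2) := by
    rw [Finset.sum_product]
    refine Finset.sum_congr rfl fun i hi => ?_
    simp only [ite_mul, zero_mul]
    rw [Finset.sum_ite_eq, if_pos hi]
  rw [Finset.sum_congr rfl h1, sum_edges, h2, ← sum_pairBox_prod]
  refine Finset.sum_congr rfl fun w _ => ?_
  rw [diagWeight, weight, ← Finset.prod_mul_distrib]
  rfl

theorem sum_chainWeight : ∑ w ∈ pairBox α α n, α.chainWeight k w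
    = (∑ q ∈ α.support ×ˢ α.support, (α q.1 * α q.2 * α (q.1 + k * q.2 - k * q.1) : ℝ)) ^ n :=
  sum_pairBox_prod fun q => (α q.1 * α q.2 * α (q.1 + k * q.2 - k * q.1) : ℝ)

/-- If `α + k·α` is spartan then `α` is not an indicator function. -/
theorem IsSpartan.exists_lt_one (hα : α.IsFractionalSet) (h : (addDilate α k α).IsSpartan) :
    ∃ i ∈ α.support, (α i : ℝ) < 1 := by
  by_contra! hc
  have h1 : ∀ i ∈ α.support, α i = 1 := fun i hi =>
    le_antisymm (hα i) (NNReal.coe_le_coe.1 (by simpa using hc i hi))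
  -- For an indicator function every non-zero value of α + k·α counts representations, so it is at
  -- least 1 and has non-negative logarithm.
  refine absurd h (not_lt.2 (Finset.sum_nonneg fun m hm => ?_))
  refine mul_nonneg (NNReal.coe_nonneg _) (Real.log_nonneg ?_)
  rw [Finsupp.mem_support_iff, addDilate_apply] at hm
  rw [addDilate_apply]
  obtain ⟨q, hq, -⟩ := Finset.exists_ne_zero_of_sum_ne_zero hm
  have hq' := hq
  simp only [Finset.mem_filter, Finset.mem_product] at hq'
  have : (1 : ℝ≥0) ≤ ∑ q ∈ (α.support ×ˢ α.support).filter (fun q => q.1 + k * q.2 = m),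
      α q.1 * α q.2 := by
    refine le_trans (le_of_eq ?_) (Finset.single_le_sum (fun _ _ => zero_le) hq)
    rw [h1 _ hq'.1.1, h1 _ hq'.1.2, one_mul]
  exact_mod_cast this

/-- For k ≠ -1 the map i ↦ (1 + k) i is injective, so the values of α + k·α involved are distinct
terms of its total mass; strictness comes from a value of α below 1. -/
theorem sum_diag_lt (hα : α.IsFractionalSet) (hk : k ≠ -1) (h : (addDilate α k α).IsSpartan) :
    ∑ i ∈ α.support, (α i * addDilate α k α (i + k * i) : ℝ) < (addDilate α k α).powSum 1 := by
  obtain ⟨i₀, hi₀, hlt⟩ := h.exists_lt_one hα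
  have hpos : ∀ i ∈ α.support, (0 : ℝ) < addDilate α k α (i + k * i) := fun i hi =>
    coe_pos_of_mem (add_mem_support_addDilate hi hi)
  calc _ < ∑ i ∈ α.support, (addDilate α k α (i + k * i) : ℝ) :=
        Finset.sum_lt_sum
          (fun i hi => mul_le_of_le_one_left (hpos i hi).le (hα.coe_le_one i))
          ⟨i₀, hi₀, mul_lt_of_lt_one_left (hpos i₀ hi₀) hlt⟩
    _ = ∑ m ∈ α.support.image fun i => i + k * i, (addDilate α k α m : ℝ) := by
        refine (Finset.sum_image (f := fun m => (addDilate α k α m : ℝ)) fun i _ j _ hij => ?_).symm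
        have h1 : (1 + k) * i = (1 + k) * j := by linarith
        exact mul_left_cancel₀ (by omega) h1
    _ ≤ _ := by
        rw [powSum_one]
        refine Finset.sum_le_sum_of_subset_of_nonneg (fun m hm => ?_)
          fun _ _ _ => NNReal.coe_nonneg _
        obtain ⟨i, hi, rfl⟩ := Finset.mem_image.1 hm
        exact add_mem_support_addDilate hi hi

/-- The third factor is at most 1; at (i₀, i₀) it equals α(i₀) < 1. -/
theorem sum_chain_lt (hα : α.IsFractionalSet) (h : (addDilate α k α).IsSpartan) :
    ∑ q ∈ α.support ×ˢ α.support, (α q.1 * α q.2 * α (q.1 + k * q.2 - k * q.1) : ℝ)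
      < (addDilate α k α).powSum 1 := by
  obtain ⟨i₀, hi₀, hlt⟩ := h.exists_lt_one hα
  rw [powSum_one_addDilate, powSum_one, Finset.sum_mul_sum, ← Finset.sum_product']
  refine Finset.sum_lt_sum (fun q _ => mul_le_of_le_one_right (by positivity) (hα.coe_le_one _))
    ⟨(i₀, i₀), Finset.mem_product.2 ⟨hi₀, hi₀⟩, ?_⟩
  have := coe_pos_of_mem hi₀
  simp only [add_sub_cancel_right]
  exact mul_lt_of_lt_one_right (by positivity) hlt

/-- A representation of m is determined by its first entry, and the second factor is at most 1. -/
theorem addDilate_le_powSum_one (hα : α.IsFractionalSet) (hk : k ≠ 0) (m : ℤ) :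
    (addDilate α k α m : ℝ) ≤ α.powSum 1 := by
  classical
  rw [addDilate_apply, powSum_one]
  push_cast
  set s := (α.support ×ˢ α.support).filter fun q => q.1 + k * q.2 = m
  have hinj : Set.InjOn Prod.fst (s : Set (ℤ × ℤ)) := by
    intro q hq r hr h
    simp only [s, Finset.coe_filter, Set.mem_ofPred_eq] at hq hr
    have h1 : k * q.2 = k * r.2 := by
      have := hq.2.trans hr.2.symm
      rw [h] at this
      linarith
    exact Prod.ext h (mul_left_cancel₀ hk h1)
  calc _ ≤ ∑ q ∈ s, (α q.1 : ℝ) := Finset.sum_le_sum fun q _ =>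
        mul_le_of_le_one_right (NNReal.coe_nonneg _) (hα.coe_le_one _)
    _ = ∑ i ∈ s.image Prod.fst, (α i : ℝ) :=
        (Finset.sum_image (f := fun i => (α i : ℝ)) hinj).symm
    _ ≤ _ := by
        refine Finset.sum_le_sum_of_subset_of_nonneg (fun i hi => ?_)
          fun _ _ _ => NNReal.coe_nonneg _
        obtain ⟨q, hq, rfl⟩ := Finset.mem_image.1 hi
        exact (Finset.mem_product.1 (Finset.mem_filter.1 hq).1).1

/-- Let A = ‖α‖. All values g of α + k·α are at most A, so g^p ≥ A^(p-1) g; as their total is A²,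
the power sum is at least A^(p+1) ≥ A. -/
theorem powSum_one_le_size_addDilate (hα : α.IsFractionalSet) (hk : k ≠ 0)
    (h1 : 1 ≤ α.powSum 1) : α.powSum 1 ≤ (addDilate α k α).size := by
  refine le_size fun p hp => ?_
  have hA : 0 < α.powSum 1 := one_pos.trans_le h1
  have hterm : ∀ m ∈ (addDilate α k α).support,
      α.powSum 1 ^ (p - 1) * (addDilate α k α m : ℝ) ≤ (addDilate α k α m : ℝ) ^ p := by
    intro m hm
    have hm0 := coe_pos_of_mem hm
    have h2 := Real.rpow_le_rpow_of_nonpos hm0 (addDilate_le_powSum_one hα hk m)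
      (by linarith [hp.2] : p - 1 ≤ 0)
    calc _ ≤ (addDilate α k α m : ℝ) ^ (p - 1) * (addDilate α k α m : ℝ) :=
          mul_le_mul_of_nonneg_right h2 hm0.le
      _ = _ := by rw [Real.rpow_sub_one hm0.ne', div_mul_cancel₀ _ hm0.ne']
  refine le_trans ?_ (Finset.sum_le_sum hterm)
  rw [← Finset.mul_sum, ← powSum_one, powSum_one_addDilate, ← mul_assoc,
    Real.rpow_sub_one hA.ne', div_mul_cancel₀ _ hA.ne']
  exact le_mul_of_one_le_left hA.le (Real.one_le_rpow h1 hp.1.le)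

end FractionalDilate

/-! ### Dependence within a fibre when both summands come from S. -/

section RandomSets

variable {Ω : Type*} [MeasurableSpace Ω] {P : Measure Ω} {n : ℕ}
  {S : Ω → Set (Fin n → ℤ)} {α : FractionalDilate} {k : ℤ}

theorem real_hit_self (hS : IsDrawnFrom P S α) (w : Fin n → ℤ × ℤ) :
    P.real (hit S S w) = ∏ x ∈ {fstVec w, sndVec w}, α.weight x := by
  rw [← hS.real_prob_finset]
  congr 1
  ext ω
  simp [hit]

theorem real_hit_self_of_eq (hS : IsDrawnFrom P S α) {w : Fin n → ℤ × ℤ}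
    (h : fstVec w = sndVec w) : P.real (hit S S w) = α.diagWeight w := by
  rw [real_hit_self hS, diagWeight_of_eq h, ← h, Finset.pair_eq_singleton,
    Finset.prod_singleton]

theorem real_hit_self_of_ne (hS : IsDrawnFrom P S α) {w : Fin n → ℤ × ℤ}
    (h : fstVec w ≠ sndVec w) : P.real (hit S S w) = α.pairWeight w := by
  rw [real_hit_self hS, Finset.prod_pair h]
  rfl

theorem real_hit_self_le (hS : IsDrawnFrom P S α) (w : Fin n → ℤ × ℤ) :
    P.real (hit S S w) ≤ α.pairWeight w + α.diagWeight w := by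
  have h1 := α.pairWeight_nonneg w
  have h2 := α.diagWeight_nonneg w
  by_cases h : fstVec w = sndVec w
  · rw [real_hit_self_of_eq hS h]; linarith
  · rw [real_hit_self_of_ne hS h]; linarith

theorem pairWeight_le_real_hit_self (hα : α.IsFractionalSet) (hS : IsDrawnFrom P S α)
    (w : Fin n → ℤ × ℤ) : α.pairWeight w ≤ P.real (hit S S w) := by
  by_cases h : fstVec w = sndVec w
  · rw [real_hit_self_of_eq hS h, diagWeight_of_eq h, pairWeight]
    exact mul_le_of_le_one_right (weight_nonneg _ _) (hα.weight_le_one _)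
  · rw [real_hit_self_of_ne hS h]

theorem real_hit_self_inter (hS : IsDrawnFrom P S α) {w u : Fin n → ℤ × ℤ}
    (h1 : fstVec w ≠ fstVec u) (h2 : sndVec w ≠ sndVec u) (h3 : fstVec w ≠ sndVec u)
    (h4 : sndVec w ≠ fstVec u) :
    P.real (hit S S w ∩ hit S S u) = P.real (hit S S w) * P.real (hit S S u) := by
  rw [real_hit_self hS, real_hit_self hS, ← Finset.prod_union, ← hS.real_prob_finset]
  · congr 1
    ext ω
    simp [hit, or_imp, forall_and]
    tauto
  · simp [Finset.disjoint_left, h1, h2, h3, h4]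

/-- The pairs (x, y) and (y, y') involve three distinct points: coincidences force equal pairs,
except x = y', which gives (k - 1)(y - y') = 0 and is excluded by k ≠ 1. -/
theorem real_hit_inter_hit_of_chain (hk : k ≠ 0) (hk1 : k ≠ 1) (hS : IsDrawnFrom P S α)
    {z : Fin n → ℤ} {w u : Fin n → ℤ × ℤ} (hw : w ∈ edges α k α z) (hu : u ∈ edges α k α z)
    (hwu : w ≠ u) (h : sndVec w = fstVec u) :
    P.real (hit S S w ∩ hit S S u) = α.pairWeight u * α.weight (fstVec w) := by
  have hz := (mem_edges.1 hw).2.trans (mem_edges.1 hu).2.symm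
  rw [vecSum, vecSum, h] at hz
  have h1 : fstVec w ≠ fstVec u := fun e => hwu (edges_ext_fst hk hw hu e)
  have h2 : fstVec u ≠ sndVec u := fun e => by
    rw [← e] at hz
    exact h1 (add_right_cancel hz)
  have h3 : fstVec w ≠ sndVec u := fun e => by
    rw [e] at hz
    have : (k - 1) • (fstVec u - sndVec u) = 0 := by
      rw [sub_smul, one_smul, smul_sub]
      rw [← sub_eq_zero] at hz
      rw [← hz]
      abel
    rcases smul_eq_zero.1 this with h | h
    · omega
    · exact h2 (sub_eq_zero.1 h)
  have := hS.real_prob_finset {fstVec w, fstVec u, sndVec u}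
  rw [Finset.prod_insert (by simp [h1, h3]), Finset.prod_pair h2] at this
  rw [mul_comm, pairWeight, ← this]
  congr 1
  ext ω
  simp [hit, h]
  tauto

theorem sum_real_hit_self_le (hS : IsDrawnFrom P S α) (z : Fin n → ℤ) :
    ∑ w ∈ edges α k α z, P.real (hit S S w)
      ≤ (addDilate α k α).weight z + ∑ w ∈ edges α k α z, α.diagWeight w := by
  rw [← sum_edges_pairWeight, ← Finset.sum_add_distrib]
  exact Finset.sum_le_sum fun w _ => real_hit_self_le hS w

theorem weight_le_sum_real_hit_self (hα : α.IsFractionalSet) (hS : IsDrawnFrom P S α)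
    (z : Fin n → ℤ) :
    (addDilate α k α).weight z ≤ ∑ w ∈ edges α k α z, P.real (hit S S w) := by
  rw [← sum_edges_pairWeight]
  exact Finset.sum_le_sum fun w _ => pairWeight_le_real_hit_self hα hS w

theorem real_hit_inter_hit_le (hk : k ≠ 0) (hk1 : k ≠ 1) (hS : IsDrawnFrom P S α)
    {z : Fin n → ℤ} (hkz : k ≠ -1 ∨ z ≠ 0) {w u : Fin n → ℤ × ℤ} (hw : w ∈ edges α k α z)
    (hu : u ∈ edges α k α z) :
    P.real (hit S S w ∩ hit S S u) ≤ (if w = u then P.real (hit S S w) else 0)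
      + α.pairWeight w * α.pairWeight u + α.diagWeight w * α.pairWeight u
      + α.pairWeight w * α.diagWeight u
      + (if sndVec w = fstVec u then α.pairWeight u * α.weight (fstVec w) else 0)
      + (if sndVec u = fstVec w then α.pairWeight w * α.weight (fstVec u) else 0) := by
  have q1 := α.pairWeight_nonneg w
  have q2 := α.pairWeight_nonneg u
  have d1 := α.diagWeight_nonneg w
  have d2 := α.diagWeight_nonneg u
  have p1 := mul_nonneg q1 q2
  have p2 := mul_nonneg d1 q2
  have p3 := mul_nonneg q1 d2
  have p4 := mul_nonneg q2 (α.weight_nonneg (fstVec w))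
  have p5 := mul_nonneg q1 (α.weight_nonneg (fstVec u))
  by_cases hwu : w = u
  · rw [if_pos hwu, ← hwu, Set.inter_self]
    subst hwu
    split_ifs <;> linarith
  rw [if_neg hwu]
  by_cases h1 : sndVec w = fstVec u
  · rw [real_hit_inter_hit_of_chain hk hk1 hS hw hu hwu h1, if_pos h1]
    split_ifs <;> linarith
  by_cases h2 : sndVec u = fstVec w
  · rw [Set.inter_comm, real_hit_inter_hit_of_chain hk hk1 hS hu hw (Ne.symm hwu) h2, if_neg h1,
      if_pos h2]
    linarith
  rw [if_neg h1, if_neg h2, real_hit_self_inter hS (fun e => hwu (edges_ext_fst hk hw hu e))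
    (fun e => hwu (edges_ext_snd hw hu e)) (Ne.symm h2) h1]
  -- Two distinct diagonal pairs never share a fibre: (1 + k) x = z determines x unless k = -1, when
  -- z would be 0.
  have hdd : α.diagWeight w * α.diagWeight u = 0 := by
    by_contra hne
    have e1 : fstVec w = sndVec w := by
      by_contra e; exact hne (by rw [diagWeight_of_ne e, zero_mul])
    have e2 : fstVec u = sndVec u := by
      by_contra e; exact hne (by rw [diagWeight_of_ne e, mul_zero])
    have hz1 := (mem_edges.1 hw).2
    have hz2 := (mem_edges.1 hu).2
    have s1 : (1 + k) • fstVec w = z := by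
      rw [add_smul, one_smul, ← hz1, vecSum, ← e1]
    have s2 : (1 + k) • fstVec u = z := by
      rw [add_smul, one_smul, ← hz2, vecSum, ← e2]
    by_cases hk2 : k = -1
    · refine hkz.elim (fun h => h hk2) fun h => h ?_
      rw [← s1, hk2]
      simp
    · exact hwu (edges_ext_fst hk hw hu
        (smul_right_injective _ (by omega : 1 + k ≠ 0) (s1.trans s2.symm)))
  have := mul_le_mul (real_hit_self_le hS w) (real_hit_self_le hS u) measureReal_nonneg
    (by linarith)
  nlinarith

/-- The sharp second moment bound: the linear term has coefficient exactly 1, so it cancels in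
`sum_sub_measureReal_biUnion_le`. Each pair has at most one chain neighbour on each side, whence the
factor 2. -/
theorem sum_sum_real_hit_self_le_chain (hk : k ≠ 0) (hk1 : k ≠ 1) (hS : IsDrawnFrom P S α)
    {z : Fin n → ℤ} (hkz : k ≠ -1 ∨ z ≠ 0) :
    ∑ w ∈ edges α k α z, ∑ u ∈ edges α k α z, P.real (hit S S w ∩ hit S S u)
      ≤ ∑ w ∈ edges α k α z, P.real (hit S S w) + (addDilate α k α).weight z ^ 2
        + 2 * ((∑ w ∈ edges α k α z, α.diagWeight w) * (addDilate α k α).weight z)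
        + 2 * ∑ w ∈ edges α k α z, α.chainWeight k w := by
  have hchain : ∀ u ∈ edges α k α z, ∑ w ∈ edges α k α z,
      (if sndVec w = fstVec u then α.pairWeight u * α.weight (fstVec w) else 0)
        ≤ α.chainWeight k u := by
    intro u hu
    refine sum_ite_le_of_unique (chainWeight_nonneg u)
      (fun a ha b hb h1 h2 => edges_ext_snd ha hb (h1.trans h2.symm)) fun w hw h => le_of_eq ?_
    rw [chainWeight_eq, ← h, (mem_edges.1 hu).2, ← (mem_edges.1 hw).2, vecSum,
      add_sub_cancel_right]
  refine (Finset.sum_le_sum fun w hw => Finset.sum_le_sum fun u hu =>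
    real_hit_inter_hit_le hk hk1 hS hkz hw hu).trans ?_
  simp only [Finset.sum_add_distrib, ← Finset.sum_mul_sum, sum_edges_pairWeight]
  have h1 : ∑ w ∈ edges α k α z, ∑ u ∈ edges α k α z, (if w = u then P.real (hit S S w) else 0)
      = ∑ w ∈ edges α k α z, P.real (hit S S w) :=
    Finset.sum_congr rfl fun w hw => by rw [Finset.sum_ite_eq, if_pos hw]
  have h2 := Finset.sum_le_sum hchain
  have h3 := h2
  rw [Finset.sum_comm] at h3
  rw [h1]
  linarith

variable [IsProbabilityMeasure P]

theorem real_hit_self_inter_le (hk : k ≠ 0) (hS : IsDrawnFrom P S α) {z : Fin n → ℤ}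
    {w u : Fin n → ℤ × ℤ} (hw : w ∈ edges α k α z) (hu : u ∈ edges α k α z) :
    P.real (hit S S w ∩ hit S S u) ≤ P.real (hit S S w) * P.real (hit S S u)
      + if (u = w ∨ sndVec u = fstVec w ∨ fstVec u = sndVec w) then P.real (hit S S w) else 0 := by
  split_ifs with h
  · exact (measureReal_mono Set.inter_subset_left).trans
      (le_add_of_nonneg_left (mul_nonneg measureReal_nonneg measureReal_nonneg))
  · push Not at h
    rw [add_zero, real_hit_self_inter hS (fun e => h.1 (edges_ext_fst hk hw hu e).symm)
      (fun e => h.1 (edges_ext_snd hw hu e).symm) h.2.1.symm h.2.2.symm]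

/-- Given w, dependence can come only from w itself and from at most one u on either side sharing a
point crosswise; hence the 3. -/
theorem sum_sum_real_hit_self_le (hk : k ≠ 0) (hS : IsDrawnFrom P S α) (z : Fin n → ℤ) :
    ∑ w ∈ edges α k α z, ∑ u ∈ edges α k α z, P.real (hit S S w ∩ hit S S u)
      ≤ (∑ w ∈ edges α k α z, P.real (hit S S w)) ^ 2
        + 3 * ∑ w ∈ edges α k α z, P.real (hit S S w) := by
  have h := sum_sum_le_sq_add (s := edges α k α z) (p := fun w => P.real (hit S S w))
    (Q := fun w u => P.real (hit S S w ∩ hit S S u))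
    (r := fun w u => if (u = w ∨ sndVec u = fstVec w ∨ fstVec u = sndVec w) then
      P.real (hit S S w) else 0)
    fun w hw u hu => real_hit_self_inter_le hk hS hw hu
  refine h.trans ?_
  rw [Finset.mul_sum, add_le_add_iff_left]
  refine Finset.sum_le_sum fun w hw => ?_
  have h0 : 0 ≤ P.real (hit S S w) := measureReal_nonneg
  calc _ ≤ ∑ u ∈ edges α k α z, ((if u = w then P.real (hit S S w) else 0)
        + (if sndVec u = fstVec w then P.real (hit S S w) else 0)
        + (if fstVec u = sndVec w then P.real (hit S S w) else 0)) := by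
        refine Finset.sum_le_sum fun u _ => ?_
        split_ifs <;> first | linarith | tauto
    _ ≤ P.real (hit S S w) + P.real (hit S S w) + P.real (hit S S w) := by
        rw [Finset.sum_add_distrib, Finset.sum_add_distrib]
        refine add_le_add (add_le_add ?_ ?_) ?_
        · exact sum_ite_le_of_unique h0 (fun _ _ _ _ h1 h2 => h1.trans h2.symm)
            fun _ _ _ => le_rfl
        · exact sum_ite_le_of_unique h0
            (fun a ha b hb h1 h2 => edges_ext_snd ha hb (h1.trans h2.symm)) fun _ _ _ => le_rfl
        · exact sum_ite_le_of_unique h0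
            (fun a ha b hb h1 h2 => edges_ext_fst hk ha hb (h1.trans h2.symm))
            fun _ _ _ => le_rfl
    _ = _ := by ring

/-- For k = 1 both crosswise neighbours are the reversal of w, so 3 improves to 2, exactly what
cancels in `half_sum_sub_measureReal_biUnion_le`. -/
theorem sum_sum_real_hit_self_le_of_one (hS : IsDrawnFrom P S α) (z : Fin n → ℤ) :
    ∑ w ∈ edges α 1 α z, ∑ u ∈ edges α 1 α z, P.real (hit S S w ∩ hit S S u)
      ≤ (∑ w ∈ edges α 1 α z, P.real (hit S S w)) ^ 2
        + 2 * ∑ w ∈ edges α 1 α z, P.real (hit S S w) := by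
  have h := sum_sum_le_sq_add (s := edges α 1 α z) (p := fun w => P.real (hit S S w))
    (Q := fun w u => P.real (hit S S w ∩ hit S S u))
    (r := fun w u => if (u = w ∨ sndVec u = fstVec w ∨ fstVec u = sndVec w) then
      P.real (hit S S w) else 0)
    fun w hw u hu => real_hit_self_inter_le one_ne_zero hS hw hu
  refine h.trans ?_
  rw [Finset.mul_sum, add_le_add_iff_left]
  refine Finset.sum_le_sum fun w hw => ?_
  have h0 : 0 ≤ P.real (hit S S w) := measureReal_nonneg
  calc _ ≤ ∑ u ∈ edges α 1 α z, ((if u = w then P.real (hit S S w) else 0)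
        + (if fstVec u = sndVec w then P.real (hit S S w) else 0)) := by
        refine Finset.sum_le_sum fun u hu => ?_
        have hiff : sndVec u = fstVec w → fstVec u = sndVec w := by
          intro h
          have h1 := (mem_edges.1 hw).2.trans (mem_edges.1 hu).2.symm
          rw [vecSum, vecSum, one_smul, one_smul, ← h, add_comm] at h1
          exact (add_right_cancel h1).symm
        split_ifs <;> first | linarith | tauto
    _ ≤ P.real (hit S S w) + P.real (hit S S w) := by
        rw [Finset.sum_add_distrib]
        refine add_le_add ?_ ?_
        · exact sum_ite_le_of_unique h0 (fun _ _ _ _ h1 h2 => h1.trans h2.symm)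
            fun _ _ _ => le_rfl
        · exact sum_ite_le_of_unique h0
            (fun a ha b hb h1 h2 => edges_ext_fst one_ne_zero ha hb (h1.trans h2.symm))
            fun _ _ _ => le_rfl
    _ = _ := by ring

theorem sum_real_hit_self_sub_le (hk : k ≠ 0) (hk1 : k ≠ 1) (hS : IsDrawnFrom P S α)
    {z : Fin n → ℤ} (hz : z ∈ (addDilate α k α).box n) (hkz : k ≠ -1 ∨ z ≠ 0) {δ : ℝ}
    (hδ : 0 < δ) (hδ1 : δ < 1) :
    ∑ w ∈ edges α k α z, P.real (hit S S w) - P.real (⋃ w ∈ edges α k α z, hit S S w)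
      ≤ (addDilate α k α).weight z ^ (1 + δ)
        + 2 * ((∑ w ∈ edges α k α z, α.diagWeight w) * (addDilate α k α).weight z)
        + 2 * ∑ w ∈ edges α k α z, α.chainWeight k w := by
  have hz0 := weight_pos hz
  have hD : 0 ≤ ∑ w ∈ edges α k α z, α.diagWeight w :=
    Finset.sum_nonneg fun w _ => α.diagWeight_nonneg w
  have hC : 0 ≤ ∑ w ∈ edges α k α z, α.chainWeight k w :=
    Finset.sum_nonneg fun w _ => chainWeight_nonneg w
  rcases le_total ((addDilate α k α).weight z) 1 with h1 | h1
  · have h2 := sum_sub_measureReal_biUnion_le (P := P) (s := edges α k α z)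
      (measurableSet_hit hS.measurable hS.measurable)
    have h3 := sum_sum_real_hit_self_le_chain hk hk1 hS hkz
    have h4 := sq_le_rpow_one_add hz0 h1 hδ1.le
    linarith
  · have h2 := sum_real_hit_self_le (k := k) hS z
    have h3 : 0 ≤ P.real (⋃ w ∈ edges α k α z, hit S S w) := measureReal_nonneg
    have h4 := self_le_rpow_one_add h1 hδ.le
    nlinarith

/-- For `k = -1` the diagonal pairs are exactly those with value zero. -/
theorem sum_real_hit_self_sub_le_of_neg_one (hS : IsDrawnFrom P S α)
    {z : Fin n → ℤ} (hz : z ∈ (addDilate α (-1) α).box n) {δ : ℝ} (hδ : 0 < δ) (hδ1 : δ < 1) :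
    ∑ w ∈ edges α (-1) α z, P.real (hit S S w) - P.real (⋃ w ∈ edges α (-1) α z, hit S S w)
      ≤ (addDilate α (-1) α).weight z ^ (1 + δ)
        + ∑ w ∈ edges α (-1) α z, α.diagWeight w
        + 2 * ∑ w ∈ edges α (-1) α z, α.chainWeight (-1) w := by
  have hC : 0 ≤ ∑ w ∈ edges α (-1) α z, α.chainWeight (-1) w :=
    Finset.sum_nonneg fun w _ => chainWeight_nonneg w
  have hdiag : ∀ w ∈ edges α (-1) α z, (fstVec w = sndVec w ↔ z = 0) := by
    intro w hw
    rw [← (mem_edges.1 hw).2, vecSum, neg_one_smul, ← sub_eq_add_neg, sub_eq_zero]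
  have hg : 0 ≤ (addDilate α (-1) α).weight z ^ (1 + δ) :=
    Real.rpow_nonneg (weight_nonneg _ _) _
  by_cases h0 : z = 0
  · have h1 : ∑ w ∈ edges α (-1) α z, P.real (hit S S w) = ∑ w ∈ edges α (-1) α z, α.diagWeight w :=
      Finset.sum_congr rfl fun w hw => real_hit_self_of_eq hS ((hdiag w hw).2 h0)
    have h3 : 0 ≤ P.real (⋃ w ∈ edges α (-1) α z, hit S S w) := measureReal_nonneg
    linarith
  · have h1 : ∑ w ∈ edges α (-1) α z, α.diagWeight w = 0 :=
      Finset.sum_eq_zero fun w hw => diagWeight_of_ne fun e => h0 ((hdiag w hw).1 e)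
    have h2 := sum_real_hit_self_sub_le (by norm_num) (by norm_num) hS hz (Or.inr h0) hδ hδ1
    rw [h1] at h2 ⊢
    linarith

/-- For `k = 1` every off-diagonal pair comes with its reversal. -/
theorem measureReal_biUnion_hit_le_half (hS : IsDrawnFrom P S α) (z : Fin n → ℤ) :
    P.real (⋃ w ∈ edges α 1 α z, hit S S w)
      ≤ (∑ w ∈ edges α 1 α z, P.real (hit S S w)
        + ∑ w ∈ edges α 1 α z, α.diagWeight w) / 2 := by
  classical
  have hm := measurableSet_hit hS.measurable hS.measurable
  have hd : ∑ w ∈ edges α 1 α z, α.diagWeight w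
      = ∑ w ∈ edges α 1 α z with fstVec w = sndVec w, P.real (hit S S w) := by
    rw [Finset.sum_filter]
    refine Finset.sum_congr rfl fun w _ => ?_
    split_ifs with h
    · exact (real_hit_self_of_eq hS h).symm
    · exact diagWeight_of_ne h
  have i1 := integrable_sum_indicator (P := P) (s := edges α 1 α z) hm
  have i2 := integrable_sum_indicator (P := P)
    (s := (edges α 1 α z).filter fun w => fstVec w = sndVec w) hm
  rw [hd, ← integral_sum_indicator hm, ← integral_sum_indicator hm, ← integral_add i1 i2,
    ← integral_div, ← integral_indicator_one
      (measurableSet_biUnion_hit hS.measurable hS.measurable (edges α 1 α z))]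
  refine integral_mono ((integrable_const (1 : ℝ)).indicator
    (measurableSet_biUnion_hit hS.measurable hS.measurable _)) ((i1.add i2).div_const 2)
    fun ω => ?_
  have hcard : ∀ s : Finset (Fin n → ℤ × ℤ), ∑ w ∈ s, (hit S S w).indicator (1 : Ω → ℝ) ω
      = ((s.filter fun w => ω ∈ hit S S w).card : ℝ) := by
    intro s
    simp [Set.indicator_apply]
  simp only [hcard]
  by_cases hω : ω ∈ ⋃ w ∈ edges α 1 α z, hit S S w
  · rw [Set.indicator_of_mem hω]
    simp only [Set.mem_iUnion, exists_prop] at hω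
    obtain ⟨w, hw, hwω⟩ := hω
    rw [Pi.one_apply, le_div_iff₀ two_pos, one_mul]
    norm_cast
    -- Hits plus diagonal hits number at least 2: a diagonal hit counts in both sums, an
    -- off-diagonal one brings its reversal.
    by_cases h : fstVec w = sndVec w
    · have h1 : 0 < ((edges α 1 α z).filter fun w => ω ∈ hit S S w).card :=
        Finset.card_pos.2 ⟨w, Finset.mem_filter.2 ⟨hw, hwω⟩⟩
      have h2 : 0 < (((edges α 1 α z).filter fun w => fstVec w = sndVec w).filter
          fun w => ω ∈ hit S S w).card :=
        Finset.card_pos.2 ⟨w, Finset.mem_filter.2 ⟨Finset.mem_filter.2 ⟨hw, h⟩, hwω⟩⟩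
      omega
    · have hsw : (fun i => (w i).swap) ∈ edges α 1 α z := by
        rw [mem_edges, mem_pairBox] at hw ⊢
        refine ⟨⟨hw.1.2, hw.1.1⟩, ?_⟩
        rw [← hw.2, vecSum, vecSum, one_smul, one_smul, add_comm]
        rfl
      have h1 : 1 < ((edges α 1 α z).filter fun w => ω ∈ hit S S w).card := by
        refine Finset.one_lt_card.2 ⟨w, Finset.mem_filter.2 ⟨hw, hwω⟩, _,
          Finset.mem_filter.2 ⟨hsw, hwω.2, hwω.1⟩, fun e => h ?_⟩
        exact congrArg fstVec e
      omega
  · rw [Set.indicator_of_notMem hω]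
    positivity

theorem abs_half_sum_real_hit_self_sub_le (hS : IsDrawnFrom P S α)
    {z : Fin n → ℤ} (hz : z ∈ (addDilate α 1 α).box n) {δ : ℝ} (hδ : 0 < δ) (hδ1 : δ < 1) :
    |1 / 2 * ∑ w ∈ edges α 1 α z, P.real (hit S S w) - P.real (⋃ w ∈ edges α 1 α z, hit S S w)|
      ≤ (addDilate α 1 α).weight z ^ (1 + δ) + 2 * ∑ w ∈ edges α 1 α z, α.diagWeight w := by
  have hz0 := weight_pos hz
  have hD : 0 ≤ ∑ w ∈ edges α 1 α z, α.diagWeight w :=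
    Finset.sum_nonneg fun w _ => α.diagWeight_nonneg w
  have hg : 0 ≤ (addDilate α 1 α).weight z ^ (1 + δ) :=
    Real.rpow_nonneg (weight_nonneg _ _) _
  rw [abs_le]
  constructor
  · have := measureReal_biUnion_hit_le_half hS z
    linarith
  · have h2 := half_sum_sub_measureReal_biUnion_le (P := P) (s := edges α 1 α z)
      (measurableSet_hit hS.measurable hS.measurable)
    have h3 := sum_sum_real_hit_self_le_of_one hS z
    have h4 := sum_real_hit_self_le (k := 1) hS z
    have h5 : 0 ≤ P.real (⋃ w ∈ edges α 1 α z, hit S S w) := measureReal_nonneg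
    have h6 : 0 ≤ ∑ w ∈ edges α 1 α z, P.real (hit S S w) :=
      Finset.sum_nonneg fun _ _ => measureReal_nonneg
    rcases le_total 1 ((addDilate α 1 α).weight z) with h1 | h1
    · have := self_le_rpow_one_add h1 hδ.le
      linarith
    -- Now g ≤ 1. If D ≥ 1, half the sum is at most (g + D)/2 ≤ D. Otherwise (g + D)²/2 ≤ g² + D² ≤
    -- g^(1+δ) + D.
    · rcases le_total 1 (∑ w ∈ edges α 1 α z, α.diagWeight w) with h7 | h7
      · linarith
      · have := sq_le_rpow_one_add hz0 h1 hδ1.le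
        set g := (addDilate α 1 α).weight z
        set D := ∑ w ∈ edges α 1 α z, α.diagWeight w
        nlinarith [pow_le_pow_left₀ h6 h4 2, sq_nonneg (g - D)]

end RandomSets

/-! ### Expectations for S + k·S. -/

section RandomSets

variable {Ω : Type*} [MeasurableSpace Ω] {P : Measure Ω} [IsProbabilityMeasure P] {n : ℕ}
  {S : Ω → Set (Fin n → ℤ)} {α : FractionalDilate} {k : ℤ}

theorem sum_min_one_weight_le_integral_self (hα : α.IsFractionalSet) (hk : k ≠ 0)
    (hS : IsDrawnFrom P S α) :
    (∑ z ∈ (addDilate α k α).box n, min 1 ((addDilate α k α).weight z)) / 4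
      ≤ ∫ ω, ((sumDilate (S ω) k (S ω)).ncard : ℝ) ∂P := by
  rw [integral_ncard_sumDilate hS hS, Finset.sum_div]
  refine Finset.sum_le_sum fun z _ => le_trans ?_ (min_one_div_four_le_measureReal_biUnion
    (measurableSet_hit hS.measurable hS.measurable) (sum_sum_real_hit_self_le hk hS z))
  exact div_le_div_of_nonneg_right
    (min_le_min_left _ (weight_le_sum_real_hit_self hα hS z)) (by norm_num)

/-- At each z the probability is at most min(1, g + D) ≤ min(1, g) + D, and the D sum to ‖α‖ⁿ. -/
theorem integral_self_le (hS : IsDrawnFrom P S α) :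
    ∫ ω, ((sumDilate (S ω) k (S ω)).ncard : ℝ) ∂P
      ≤ (addDilate α k α).size ^ n + α.powSum 1 ^ n := by
  rw [integral_ncard_sumDilate hS hS]
  refine le_trans ?_ (add_le_add_left (sum_min_one_weight_le _ n) _)
  rw [← sum_diagWeight, ← sum_edges (k := k), ← Finset.sum_add_distrib]
  refine Finset.sum_le_sum fun z _ => ?_
  have hD : 0 ≤ ∑ w ∈ edges α k α z, α.diagWeight w :=
    Finset.sum_nonneg fun w _ => α.diagWeight_nonneg w
  rw [← min_add_add_right]
  exact le_min (measureReal_le_one.trans (by linarith))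
    ((measureReal_biUnion_finset_le _ _).trans (sum_real_hit_self_le hS z))

/-- If S is non-empty, S + k·S contains a translate of S. This is the lower bound when ‖α‖ < 1. -/
theorem powSum_one_pow_le_integral_self (hS : IsDrawnFrom P S α) :
    α.powSum 1 ^ n ≤ ∫ ω, ((sumDilate (S ω) k (S ω)).ncard : ℝ) ∂P := by
  rw [← integral_ncard hS]
  refine integral_mono_ae (integrable_ncard hS) (integrable_ncard_sumDilate hS hS k) ?_
  filter_upwards [hS.ae_subset_box] with ω hω
  have hfin : (S ω).Finite := (Finset.finite_toSet _).subset hω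
  rcases (S ω).eq_empty_or_nonempty with h | ⟨y, hy⟩
  · simp [h]
  · rw [Nat.cast_le, ← Set.ncard_image_of_injective (S ω) (add_left_injective (k • y))]
    refine Set.ncard_le_ncard ?_ (hfin.image2 _ hfin)
    rintro _ ⟨x, hx, rfl⟩
    exact ⟨x, hx, y, hy, rfl⟩

theorem sum_edges_diagWeight (α : FractionalDilate) (k : ℤ) (n : ℕ) :
    ∑ z ∈ (addDilate α k α).box n, ∑ w ∈ edges α k α z, α.diagWeight w = α.powSum 1 ^ n := by
  rw [sum_edges, sum_diagWeight]

theorem abs_integral_self_sub_le (hk : k ≠ 0) (hk1 : k ≠ 1) (hk2 : k ≠ -1)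
    (hS : IsDrawnFrom P S α) {δ : ℝ} (hδ : 0 < δ) (hδ1 : δ < 1) :
    |∫ ω, (((S ω).ncard : ℝ) ^ 2 - ((sumDilate (S ω) k (S ω)).ncard : ℝ)) ∂P|
      ≤ (addDilate α k α).powSum (1 + δ) ^ n
        + 2 * (∑ i ∈ α.support, (α i * addDilate α k α (i + k * i) : ℝ)) ^ n
        + 2 * (∑ q ∈ α.support ×ˢ α.support,
          (α q.1 * α q.2 * α (q.1 + k * q.2 - k * q.1) : ℝ)) ^ n := by
  have h := integral_mul_sub_ncard_sumDilate hS hS k 1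
  simp only [one_mul, ← sq] at h
  rw [h, ← sum_weight_rpow, ← sum_edges_diagWeight_mul_weight, ← sum_chainWeight,
    ← sum_edges (k := k) (α.chainWeight k), Finset.mul_sum, Finset.mul_sum, ← Finset.sum_add_distrib,
    ← Finset.sum_add_distrib]
  refine (Finset.abs_sum_le_sum_abs _ _).trans (Finset.sum_le_sum fun z hz => ?_)
  rw [abs_of_nonneg (sub_nonneg.2 (measureReal_biUnion_finset_le _ _))]
  exact sum_real_hit_self_sub_le hk hk1 hS hz (Or.inl hk2) hδ hδ1

theorem abs_integral_self_sub_le_of_neg_one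
    (hS : IsDrawnFrom P S α) {δ : ℝ} (hδ : 0 < δ) (hδ1 : δ < 1) :
    |∫ ω, (((S ω).ncard : ℝ) ^ 2 - ((sumDilate (S ω) (-1) (S ω)).ncard : ℝ)) ∂P|
      ≤ (addDilate α (-1) α).powSum (1 + δ) ^ n + α.powSum 1 ^ n
        + 2 * (∑ q ∈ α.support ×ˢ α.support,
          (α q.1 * α q.2 * α (q.1 + (-1) * q.2 - (-1) * q.1) : ℝ)) ^ n := by
  have h := integral_mul_sub_ncard_sumDilate hS hS (-1) 1
  simp only [one_mul, ← sq] at h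
  rw [h, ← sum_weight_rpow, ← sum_edges_diagWeight α (-1) n, ← sum_chainWeight,
    ← sum_edges (k := -1) (α.chainWeight (-1)), Finset.mul_sum, ← Finset.sum_add_distrib,
    ← Finset.sum_add_distrib]
  refine (Finset.abs_sum_le_sum_abs _ _).trans (Finset.sum_le_sum fun z hz => ?_)
  rw [abs_of_nonneg (sub_nonneg.2 (measureReal_biUnion_finset_le _ _))]
  exact sum_real_hit_self_sub_le_of_neg_one hS hz hδ hδ1

theorem abs_integral_half_self_sub_le
    (hS : IsDrawnFrom P S α) {δ : ℝ} (hδ : 0 < δ) (hδ1 : δ < 1) :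
    |∫ ω, (((S ω).ncard : ℝ) ^ 2 / 2 - ((sumDilate (S ω) 1 (S ω)).ncard : ℝ)) ∂P|
      ≤ (addDilate α 1 α).powSum (1 + δ) ^ n + 2 * α.powSum 1 ^ n := by
  have h := integral_mul_sub_ncard_sumDilate hS hS 1 (1 / 2)
  simp only [← sq, one_div, inv_mul_eq_div] at h
  rw [h, ← sum_weight_rpow, ← sum_edges_diagWeight α 1 n, Finset.mul_sum,
    ← Finset.sum_add_distrib]
  refine (Finset.abs_sum_le_sum_abs _ _).trans (Finset.sum_le_sum fun z hz => ?_)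
  have := abs_half_sum_real_hit_self_sub_le hS hz hδ hδ1
  rwa [one_div_mul_eq_div] at this

end RandomSets

/-! ### Assembly of the six assertions. -/

theorem theoremT
    (α β : FractionalDilate) (hα : α.IsFractionalSet) (hβ : β.IsFractionalSet)
    (k : ℤ) (hk : k ≠ 0)
    {Ω : ℕ → Type*} [∀ n, MeasurableSpace (Ω n)]
    (P : ∀ n, Measure (Ω n)) [∀ n, IsProbabilityMeasure (P n)]
    (S T : ∀ n, Ω n → Set (Fin n → ℤ))
    (hS : ∀ n, IsDrawnFrom (P n) (S n) α)
    (hT : ∀ n, IsDrawnFrom (P n) (T n) β)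
    (hST : ∀ n, IndepFun (S n) (T n) (P n)) :
    Tendsto
      (fun n : ℕ =>
        (∫ ω, ((sumDilate (S n ω) k (T n ω)).ncard : ℝ) ∂(P n)) ^ (1 / (n : ℝ)))
      atTop (𝓝 (α.addDilate k β).size) ∧
    (1 ≤ α.size →
      Tendsto
        (fun n : ℕ =>
          (∫ ω, ((sumDilate (S n ω) k (S n ω)).ncard : ℝ) ∂(P n)) ^ (1 / (n : ℝ)))
        atTop (𝓝 (α.addDilate k α).size)) ∧
    (α.size < 1 →
      Tendsto
        (fun n : ℕ =>
          (∫ ω, ((sumDilate (S n ω) k (S n ω)).ncard : ℝ) ∂(P n)) ^ (1 / (n : ℝ)))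
        atTop (𝓝 α.size)) ∧
    ((α.addDilate k β).IsSpartan →
      (fun n : ℕ =>
        ∫ ω, (((S n ω).ncard : ℝ) * ((T n ω).ncard : ℝ)
          - ((sumDilate (S n ω) k (T n ω)).ncard : ℝ)) ∂(P n))
        =o[atTop] fun n : ℕ => (α.addDilate k β).size ^ n) ∧
    ((α.addDilate k α).IsSpartan → k ≠ 1 → (k = -1 → 1 < α.size) →
      (fun n : ℕ =>
        ∫ ω, (((S n ω).ncard : ℝ) ^ 2
          - ((sumDilate (S n ω) k (S n ω)).ncard : ℝ)) ∂(P n))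
        =o[atTop] fun n : ℕ => (α.addDilate k α).size ^ n) ∧
    ((α.addDilate k α).IsSpartan → k = 1 → 1 < α.size →
      (fun n : ℕ =>
        ∫ ω, (((S n ω).ncard : ℝ) ^ 2 / 2
          - ((sumDilate (S n ω) k (S n ω)).ncard : ℝ)) ∂(P n))
        =o[atTop] fun n : ℕ => (α.addDilate k α).size ^ n) := by
  have hA0 := α.powSum_nonneg 1
  refine ⟨?_, fun h => ?_, fun h => ?_, fun h => ?_, fun h hk1 hk2 => ?_, fun h hk1 hA => ?_⟩
  · exact tendsto_rpow_one_div_of_sum_min_one_weight one_pos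
      (fun n => integral_nonneg fun _ => Nat.cast_nonneg _)
      (fun n => by
        rw [one_mul]
        exact integral_le_size_pow_of_indepFun (hS n) (hT n) (hST n))
      fun n => sum_min_one_weight_le_integral_of_indepFun hk (hS n) (hT n) (hST n)
  · rw [hα.size_eq_powSum_one] at h
    refine tendsto_rpow_one_div_of_sum_min_one_weight two_pos
      (fun n => integral_nonneg fun _ => Nat.cast_nonneg _)
      (fun n => (integral_self_le (hS n)).trans ?_)
      fun n => sum_min_one_weight_le_integral_self hα hk (hS n)
    have := pow_le_pow_left₀ hA0 (powSum_one_le_size_addDilate hα hk h) n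
    linarith
  · rw [hα.size_eq_powSum_one] at h ⊢
    refine tendsto_rpow_one_div_of_bounds hA0
      (fun n => integral_nonneg fun _ => Nat.cast_nonneg _) two_pos
      (fun n => (integral_self_le (hS n)).trans ?_) fun ε hε => ⟨1, one_pos, ?_⟩
    -- When ‖α‖ < 1, the size of α + k·α is at most ‖α‖² ≤ ‖α‖, so the diagonal term dominates.
    · have h1 : (addDilate α k α).size ≤ α.powSum 1 := by
        refine ((addDilate α k α).size_le_powSum_of_mem_Icc (p := 1) (by simp)).trans ?_
        rw [powSum_one_addDilate]
        exact mul_le_of_le_one_left hA0 h.le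
      have := pow_le_pow_left₀ (size_nonneg _) h1 n
      linarith
    · refine Eventually.of_forall fun n => ?_
      rw [one_mul]
      refine le_trans (pow_le_pow_left₀ (by positivity) ?_ n)
        (powSum_one_pow_le_integral_self (hS n))
      exact mul_le_of_le_one_left hA0 (Real.exp_le_one_iff.2 (by linarith))
  · obtain ⟨δ, hδ, hδ1, hlt⟩ := h.exists_powSum_lt
    rw [h.size_eq_powSum_one]
    exact IsLittleO.of_abs_le
      (fun n => abs_integral_sub_le_of_indepFun hk (hS n) (hT n) (hST n) hδ hδ1)
      (isLittleO_pow_pow_of_lt_left (powSum_nonneg _ _) hlt)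
  · obtain ⟨δ, hδ, hδ1, hlt⟩ := h.exists_powSum_lt
    have hF := isLittleO_pow_pow_of_lt_left (powSum_nonneg _ _) hlt
    have hC := isLittleO_pow_pow_of_lt_left
      (Finset.sum_nonneg fun _ _ => by positivity) (sum_chain_lt hα h)
    rw [h.size_eq_powSum_one]
    by_cases hk3 : k = -1
    · have hA := hk2 hk3
      rw [hα.size_eq_powSum_one] at hA
      subst hk3
      -- For k = -1 all diagonal pairs fall on z = 0 and `sum_diag_lt` is unavailable; their total
      -- ‖α‖ⁿ is negligible against ‖α‖²ⁿ because ‖α‖ > 1.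
      have hD : (fun n : ℕ => α.powSum 1 ^ n)
          =o[atTop] fun n : ℕ => (addDilate α (-1) α).powSum 1 ^ n := by
        refine isLittleO_pow_pow_of_lt_left hA0 ?_
        rw [powSum_one_addDilate]
        exact lt_mul_of_one_lt_left (by linarith) hA
      exact IsLittleO.of_abs_le (fun n => abs_integral_self_sub_le_of_neg_one (hS n) hδ hδ1)
        ((hF.add hD).add (hC.const_mul_left 2))
    · have hD := isLittleO_pow_pow_of_lt_left
        (Finset.sum_nonneg fun _ _ => by positivity) (sum_diag_lt hα hk3 h)
      exact IsLittleO.of_abs_le (fun n => abs_integral_self_sub_le hk hk1 hk3 (hS n) hδ hδ1)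
        ((hF.add (hD.const_mul_left 2)).add (hC.const_mul_left 2))
  · obtain ⟨δ, hδ, hδ1, hlt⟩ := h.exists_powSum_lt
    have hF := isLittleO_pow_pow_of_lt_left (powSum_nonneg _ _) hlt
    rw [h.size_eq_powSum_one]
    rw [hα.size_eq_powSum_one] at hA
    subst hk1
    have hD : (fun n : ℕ => α.powSum 1 ^ n)
        =o[atTop] fun n : ℕ => (addDilate α 1 α).powSum 1 ^ n := by
      refine isLittleO_pow_pow_of_lt_left hA0 ?_
      rw [powSum_one_addDilate]
      exact lt_mul_of_one_lt_left (by linarith) hA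
    exact IsLittleO.of_abs_le (fun n => abs_integral_half_self_sub_le (hS n) hδ hδ1)
      (hF.add (hD.const_mul_left 2))
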